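/- Let $X$ be the $1$-regular tree, i.e. the rooted tree in which every vertex has exactly one child and every edge is an isometric copy of the unit interval; for $x\in X$ let $|x|\in[0,\infty)$ be the height of $x$ above the root $0$, so that $x\mapsto|x|$ identifies $X$ with the half line $[0,\infty)$, and write $x\le y$ if $|x|\le|y|$. Let $\lambda,\mu:[0,\infty)\to(0,\infty)$ be locally integrable, put $ds(x)=\lambda(|x|)\,d|x|$, $d\mu(x)=\mu(|x|)\,d|x|$, and let $d(z,y)=\int_{[z,y]}ds$, where $[z,y]$ is the geodesic between $z$ and $y$. Assume that $(X,d)$ has infinite diameter. Let $B(x,r)=\{y\in X: d(x,y)<r\}$ and $F(x,r)=\{y\in X: x\le y,\ d(x,y)<r\}$; for $x\in X$ and $r>0$ let $\bar x^r$ be the point of $[0,x]$ with $d(\bar x^r,x)=\min\{r,d(0,x)\}$ and $\underline x_r\ge x$ the point with $d(\underline x_r,x)=r$. For $1<p<\infty$ set $$A_p(x,r)=\frac{\mu(F(\bar x^r,2r))}{2r}\left(\frac1r\int_{[x,\underline x_r]}\left(\frac{\mu(w)}{\lambda(w)}\right)^{\frac1{1-p}}ds(w)\right)^{p-1},$$ and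 set $$A_1(x,r)=\frac{\mu(F(\bar x^r,2r))}{2r}\ \operatorname*{ess\,sup}_{w\in[x,\underline x_r]}\frac{\lambda(w)}{\mu(w)}.$$ A Borel function $g:X\to[0,\infty]$ is an upper gradient of $u:X\to\mathbb R$ if $|u(z)-u(y)|\le\int_{[z,y]}g\,ds$ for all $z,y\in X$. The measure $\mu$ is called $p$-admissible if - it is doubling: there is $C_d>0$ with $\mu(B(x,2r))\le C_d\,\mu(B(x,r))$ for all $x\in X$, $r>0$; and - it supports a $(1,p)$-Poincaré inequality: there are $C_P>0$ and $\sigma\ge1$ such that for all $x\in X$ and $r>0$, all $u:X\to\mathbb R$ that are $\mu$-integrable on $B(x,\sigma r)$, and all upper gradients $g$ of $u$, $$\frac1{\mu(B(x,r))}\int_{B(x,r)}|u-u_{B(x,r)}|\,d\mu\le C_P\,r\left(\frac1{\mu(B(x,\sigma r))}\int_{B(x,\sigma r)}g^p\,d\mu\right)^{1/p},$$ where $u_B=\frac1{\mu(B)}\int_Bu\,d\mu$. Then for every $1\le p<\infty$ and every constant $1<c<\infty$, the measure $\mu$ is $p$-admissible if and only if $$\sup\{A_p(x,r): x\in X,\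 0<r\le c\,d(0,x)\}<\infty.$$ -/

import Mathlib

open MeasureTheory Set
open scoped NNReal ENNReal

namespace RegularTree

/-- The `1`-regular tree `X`: the rooted tree in which every vertex has exactly one child, each edge
being an isometric copy of the unit interval. It is the ray whose vertices are the natural numbers;
a point `x` of `X` is given by its height `|x| ∈ [0, ∞)` and the root is `0`. The tree order
(`x ≤ y` iff `x` lies on the geodesic `[0, y]`) is the order of `ℝ≥0`, the geodesic between `z` and
`y` is `Set.uIcc z y`. -/
abbrev OneRegularTree : Type := ℝ≥0

/-- The length element `d|x|` on `X`: Lebesgue measure on `[0, ∞)`. -/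
noncomputable def heightMeasure : Measure OneRegularTree :=
  (volume : Measure ℝ).comap ((↑) : ℝ≥0 → ℝ)

/-- `f : [0, ∞) → (0, ∞)` is positive and locally integrable. -/
def IsWeight (f : ℝ≥0 → ℝ) : Prop :=
  (∀ t, 0 < f t) ∧ LocallyIntegrable f heightMeasure

/-- The measure `f(|x|) d|x|` on `X`. It gives `ds` for `f = λ` and `dμ` for `f = μ`. -/
noncomputable def radialMeasure (f : ℝ≥0 → ℝ) : Measure OneRegularTree :=
  heightMeasure.withDensity fun t => ENNReal.ofReal (f t)

/-- The distance `d(z, y) = ∫_{[z, y]} ds`, with `ds = λ(|x|) d|x|`. -/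
noncomputable def treeDist (lam : ℝ≥0 → ℝ) (z y : OneRegularTree) : ℝ :=
  (radialMeasure lam).real (uIcc z y)

/-- The diameter of `(X, d)` is infinite. -/
def HasInfiniteDiameter (lam : ℝ≥0 → ℝ) : Prop :=
  ∀ R : ℝ, ∃ z y : OneRegularTree, R < treeDist lam z y

/-- The open ball `B(x, r)` of `(X, d)`. -/
def treeBall (lam : ℝ≥0 → ℝ) (x : OneRegularTree) (r : ℝ) : Set OneRegularTree :=
  {y | treeDist lam x y < r}

/-- The downward directed half ball `F(x, r) = {y : x ∈ [0, y], d(x, y) < r}`. -/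
def halfBall (lam : ℝ≥0 → ℝ) (x : OneRegularTree) (r : ℝ) : Set OneRegularTree :=
  {y | x ≤ y ∧ treeDist lam x y < r}

/-- The measure `dμ = μ(|x|) d|x|` is doubling on `(X, d)`. -/
def IsDoubling (lam mu : ℝ≥0 → ℝ) : Prop :=
  ∃ C : ℝ, 0 < C ∧ ∀ (x : OneRegularTree) (r : ℝ), 0 < r →
    radialMeasure mu (treeBall lam x (2 * r)) ≤
      ENNReal.ofReal C * radialMeasure mu (treeBall lam x r)

/-- The Borel function `g : X → [0, ∞]` is an upper gradient of `u` on `(X, d)`. -/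
def IsUpperGradient (lam : ℝ≥0 → ℝ) (u : OneRegularTree → ℝ) (g : OneRegularTree → ℝ≥0∞) : Prop :=
  Measurable g ∧ ∀ z y : OneRegularTree,
    ENNReal.ofReal |u z - u y| ≤ ∫⁻ w in uIcc z y, g w ∂(radialMeasure lam)

/-- `(X, d, μ)` supports a `(1, p)`-Poincaré inequality. -/
def SupportsPoincare (p : ℝ) (lam mu : ℝ≥0 → ℝ) : Prop :=
  ∃ C σ : ℝ, 0 < C ∧ 1 ≤ σ ∧ ∀ (x : OneRegularTree) (r : ℝ), 0 < r →
    ∀ (u : OneRegularTree → ℝ) (g : OneRegularTree → ℝ≥0∞),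
      IntegrableOn u (treeBall lam x (σ * r)) (radialMeasure mu) →
      IsUpperGradient lam u g →
      (⨍⁻ y in treeBall lam x r,
          ENNReal.ofReal |u y - ⨍ z in treeBall lam x r, u z ∂(radialMeasure mu)|
            ∂(radialMeasure mu)) ≤
        ENNReal.ofReal (C * r) *
          (⨍⁻ y in treeBall lam x (σ * r), g y ^ p ∂(radialMeasure mu)) ^ (1 / p)

/-- `μ` is `p`-admissible: it is doubling and supports a `(1, p)`-Poincaré inequality. -/
def IsAdmissible (p : ℝ) (lam mu : ℝ≥0 → ℝ) : Prop :=
  IsDoubling lam mu ∧ SupportsPoincare p lam mu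

/-- The point `x̄ʳ` of `[0, x]` with `d(x̄ʳ, x) = min {r, d(0, x)}`. -/
noncomputable def ancestor (lam : ℝ≥0 → ℝ) (x : OneRegularTree) (r : ℝ) : OneRegularTree :=
  Classical.epsilon fun y => y ≤ x ∧ treeDist lam y x = min r (treeDist lam 0 x)

/-- The point `x̲ᵣ` with `x ∈ [0, x̲ᵣ]` and `d(x̲ᵣ, x) = r`. -/
noncomputable def descendant (lam : ℝ≥0 → ℝ) (x : OneRegularTree) (r : ℝ) : OneRegularTree :=
  Classical.epsilon fun y => x ≤ y ∧ treeDist lam y x = r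

lemma measurableEmbedding_toReal : MeasurableEmbedding ((↑) : ℝ≥0 → ℝ) :=
  NNReal.isClosedEmbedding_coe.measurableEmbedding

lemma integrableOn_weight {f : ℝ≥0 → ℝ} (hf : IsWeight f) (a b : ℝ≥0) :
    IntegrableOn f (uIcc a b) heightMeasure :=
  hf.2.integrableOn_isCompact isCompact_uIcc

lemma map_heightMeasure : heightMeasure.map ((↑) : ℝ≥0 → ℝ) = volume.restrict (Ici 0) := by
  rw [heightMeasure, measurableEmbedding_toReal.map_comap]
  congr 1
  ext x; simp

lemma treeDist_eq_intervalIntegral {f : ℝ≥0 → ℝ} (hf : IsWeight f) (a b : ℝ≥0) (hab : a ≤ b) :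
    treeDist f a b = ∫ s in (a:ℝ)..b, f s.toNNReal := by
  have h1 : treeDist f a b = ∫ t in uIcc a b, f t ∂heightMeasure := by
    rw [treeDist, Measure.real, radialMeasure, withDensity_apply _ measurableSet_uIcc,
      integral_eq_lintegral_of_nonneg_ae (Filter.Eventually.of_forall fun t => (hf.1 t).le)
        (integrableOn_weight hf a b).aestronglyMeasurable]
  have h2 : uIcc a b = ((↑) : ℝ≥0 → ℝ) ⁻¹' (Icc (a:ℝ) b) := by
    rw [uIcc_of_le hab]; ext x; simp
  have h3 : (∫ t in uIcc a b, f t ∂heightMeasure)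
      = ∫ s in Icc (a:ℝ) b, f s.toNNReal ∂(heightMeasure.map ((↑) : ℝ≥0 → ℝ)) := by
    rw [measurableEmbedding_toReal.setIntegral_map, h2]
    simp
  rw [h1, h3, map_heightMeasure, Measure.restrict_restrict measurableSet_Icc,
    inter_eq_left.2, integral_Icc_eq_integral_Ioc, intervalIntegral.integral_of_le (by exact_mod_cast hab)]
  intro x hx
  exact le_trans a.2 hx.1

lemma intervalIntegrable_weight {f : ℝ≥0 → ℝ} (hf : IsWeight f) (a b : ℝ≥0) :
    IntervalIntegrable (fun s : ℝ => f s.toNNReal) volume a b := by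
  wlog hab : a ≤ b
  · exact (this hf b a (le_of_not_ge hab)).symm
  rw [intervalIntegrable_iff_integrableOn_Icc_of_le (by exact_mod_cast hab)]
  have h := integrableOn_weight hf a b
  have h2 : uIcc a b = ((↑) : ℝ≥0 → ℝ) ⁻¹' (Icc (a:ℝ) b) := by
    rw [uIcc_of_le hab]; ext x; simp
  have : IntegrableOn (fun s : ℝ => f s.toNNReal) (Icc (a:ℝ) b) (heightMeasure.map ((↑) : ℝ≥0 → ℝ)) := by
    rw [measurableEmbedding_toReal.integrableOn_map_iff, ← h2]
    simpa [Function.comp_def] using h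
  rw [map_heightMeasure, IntegrableOn, Measure.restrict_restrict measurableSet_Icc, inter_eq_left.2] at this
  · exact this
  intro x hx
  exact le_trans a.2 hx.1

lemma treeDist_comm (f : ℝ≥0 → ℝ) (a b : ℝ≥0) : treeDist f a b = treeDist f b a := by
  rw [treeDist, treeDist, uIcc_comm]

lemma treeDist_trans_eq {f : ℝ≥0 → ℝ} (hf : IsWeight f) {a b c : ℝ≥0} (hab : a ≤ b) (hbc : b ≤ c) :
    treeDist f a c = treeDist f a b + treeDist f b c := by
  rw [treeDist_eq_intervalIntegral hf _ _ hab, treeDist_eq_intervalIntegral hf _ _ hbc, treeDist_eq_intervalIntegral hf _ _ (hab.trans hbc),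
    intervalIntegral.integral_add_adjacent_intervals (intervalIntegrable_weight hf _ _) (intervalIntegrable_weight hf _ _)]

lemma continuous_treeDist {f : ℝ≥0 → ℝ} (hf : IsWeight f) : Continuous (fun y : ℝ≥0 => treeDist f 0 y) := by
  rw [continuous_iff_continuousAt]
  intro y
  have h : ContinuousOn (fun b : ℝ => ∫ s in (0:ℝ)..b, f s.toNNReal) (uIcc 0 ((y + 1 : ℝ≥0) : ℝ)) := by
    apply intervalIntegral.continuousOn_primitive_interval'
    · have := intervalIntegrable_weight hf 0 (y+1); simpa using this
    · simp
  have hc : ContinuousOn (fun b : ℝ≥0 => treeDist f 0 b) (Icc 0 (y+1)) := by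
    have := h.comp (f := ((↑) : ℝ≥0 → ℝ)) (s := Icc 0 (y+1)) NNReal.continuous_coe.continuousOn ?_
    · refine this.congr ?_
      intro b hb
      simpa using treeDist_eq_intervalIntegral hf 0 b hb.1
    · intro b hb
      rw [uIcc_of_le (by positivity)]
      exact ⟨b.2, by exact_mod_cast hb.2⟩
  apply hc.continuousAt
  have : Iio (y+1) ∈ nhds y := Iio_mem_nhds (by simp)
  filter_upwards [this] with z hz
  exact ⟨zero_le, le_of_lt hz⟩

lemma treeDist_self (f : ℝ≥0 → ℝ) (hf : IsWeight f) (a) : treeDist f a a = 0 := by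
  rw [treeDist_eq_intervalIntegral hf _ _ le_rfl]; simp

lemma treeDist_nonneg (f : ℝ≥0 → ℝ) (a b) : 0 ≤ treeDist f a b := measureReal_nonneg

/-- The point chosen in `ancestor` has the required property. -/
lemma ancestor_spec {f : ℝ≥0 → ℝ} (hf : IsWeight f) (x : ℝ≥0) {r : ℝ} (hr : 0 ≤ r) :
    ancestor f x r ≤ x ∧ treeDist f (ancestor f x r) x = min r (treeDist f 0 x) := by
  refine Classical.epsilon_spec (p := fun y => y ≤ x ∧ treeDist f y x = min r (treeDist f 0 x)) ?_
  have := intermediate_value_Icc (zero_le : 0 ≤ x) (continuous_treeDist hf).continuousOn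
  have hm : treeDist f 0 x - min r (treeDist f 0 x) ∈ Icc (treeDist f 0 0) (treeDist f 0 x) := by
    rw [treeDist_self f hf]; exact ⟨by simp, by simp [hr, treeDist_nonneg]⟩
  obtain ⟨y, hy, h⟩ := this hm
  exact ⟨y, hy.2, by have := treeDist_trans_eq hf hy.1 hy.2; simp only at h; linarith⟩

/-- The point chosen in `descendant` has the required property. -/
lemma descendant_spec {f : ℝ≥0 → ℝ} (hf : IsWeight f) (hd : HasInfiniteDiameter f) (x : ℝ≥0) {r : ℝ} (hr : 0 ≤ r) :
    x ≤ descendant f x r ∧ treeDist f (descendant f x r) x = r := by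
  refine Classical.epsilon_spec (p := fun y => x ≤ y ∧ treeDist f y x = r) ?_
  obtain ⟨a, b, hab⟩ := hd (treeDist f 0 x + r)
  wlog h : a ≤ b
  · exact this hf hd x hr b a (by rwa [treeDist_comm f b a]) (le_of_not_ge h)
  have h1 := treeDist_trans_eq hf (zero_le : 0 ≤ a) h
  have h2 := treeDist_nonneg f 0 a
  have hxb : x ≤ b := by
    by_contra! hc
    have := treeDist_trans_eq hf (zero_le : 0 ≤ b) hc.le
    have := treeDist_nonneg f b x
    linarith
  have hm : treeDist f 0 x + r ∈ Icc (treeDist f 0 x) (treeDist f 0 b) :=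
    ⟨by linarith, by linarith⟩
  obtain ⟨y, hy, h⟩ := intermediate_value_Icc hxb (continuous_treeDist hf).continuousOn hm
  exact ⟨y, hy.1, by rw [treeDist_comm]; have := treeDist_trans_eq hf (zero_le : 0 ≤ x) hy.1; simp only at h; linarith⟩

/-- The quantity `A_p(x, r) ∈ [0, ∞]` for `1 ≤ p < ∞`; the factors `K ^ (j(w) - j(x))` are `1`
since `K = 1`. -/
noncomputable def apQuantity (p : ℝ) (lam mu : ℝ≥0 → ℝ) (x : OneRegularTree) (r : ℝ) : ℝ≥0∞ :=
  radialMeasure mu (halfBall lam (ancestor lam x r) (2 * r)) / ENNReal.ofReal (2 * r) *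
    if p = 1 then
      essSup (fun w => ENNReal.ofReal (lam w / mu w))
        ((radialMeasure lam).restrict (Icc x (descendant lam x r)))
    else
      ((∫⁻ w in Icc x (descendant lam x r),
          ENNReal.ofReal ((mu w / lam w) ^ (1 / (1 - p))) ∂(radialMeasure lam)) /
        ENNReal.ofReal r) ^ (p - 1)

/-- The `A_p`-condition far from `0` with constant `c`:
`sup {A_p(x, r) : x ∈ X, 0 < r ≤ c d(0, x)} < ∞`. -/
def ApFarFromRoot (c p : ℝ) (lam mu : ℝ≥0 → ℝ) : Prop :=
  (⨆ (x : OneRegularTree) (r : ℝ) (_ : 0 < r ∧ r ≤ c * treeDist lam 0 x),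
    apQuantity p lam mu x r) < ∞

end RegularTree

/-! The coordinate `t = d(0, x)` identifies `(X, d)` with `[0, ∞)`; `ds` becomes Lebesgue measure
and `dμ = w ds` with `w = μ/λ`. Write `J = [x, x̲ᵣ]` and `F = F(x̄ʳ, 2r)`. By Hölder's inequality
and its converse, bounding `A_p(x, r)` amounts to `μ(F) (∫_J g ds)^p ≤ K r^p ∫_J g^p dμ` for all
Borel `g ≥ 0`. This is `AveragingBound`; it treats `p = 1` and `p > 1` alike and mediates between
both sides of the equivalence.

Necessity (`exists_averagingBound_of_isAdmissible`): the Poincaré inequality on `B(x, 2r)` is tested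
on the primitive `u` of `g 1_J`, which is `0` below `x` and `I = ∫_J g ds` above `x̲ᵣ`. Since `r ≤ c
d(0, x)`, doubling makes both of these parts a fixed fraction of the ball, so the mean oscillation
of `u` is at least a multiple of `I`.

Sufficiency: `g = 1` on a short piece of `J` compares `μ(F)` with the measure of that piece, which
gives doubling away from the root. At the root `c > 1` is essential: for `r = c d(0, x)` the set `F`
is `[0, 2r)` in the coordinate, and `2r` exceeds `d(0, x̲ᵣ) = (1 + c) d(0, x)`. Iteration gives
doubling there. For the Poincaré inequality (`AveragingBound.supportsPoincare`), `u` is compared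
with its value at the upper end of the ball; near the root the resulting integrals of `g` are split
over shells whose radii form a geometric sequence. -/

namespace RegularTree

variable {lam mu : ℝ≥0 → ℝ} {p c : ℝ} {K : ℝ≥0∞}

/-! ### The coordinate `d(0, x)` on the half line -/

/-- The distance to the root. -/
noncomputable def rootDist (lam : ℝ≥0 → ℝ) (x : ℝ≥0) : ℝ := treeDist lam 0 x

lemma rootDist_nonneg (x : ℝ≥0) : 0 ≤ rootDist lam x := treeDist_nonneg _ _ _

lemma rootDist_zero (hlam : IsWeight lam) : rootDist lam 0 = 0 := treeDist_self _ hlam _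

lemma continuous_rootDist (hlam : IsWeight lam) : Continuous (rootDist lam) :=
  continuous_treeDist hlam

lemma treeDist_eq_sub (hlam : IsWeight lam) {x y : ℝ≥0} (h : x ≤ y) :
    treeDist lam x y = rootDist lam y - rootDist lam x := by
  have := treeDist_trans_eq hlam (zero_le : 0 ≤ x) h
  simp only [rootDist]; linarith

lemma strictMono_rootDist (hlam : IsWeight lam) : StrictMono (rootDist lam) := by
  intro x y h
  have h1 := treeDist_eq_sub hlam h.le
  have h2 : 0 < treeDist lam x y := by
    rw [treeDist_eq_intervalIntegral hlam _ _ h.le]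
    exact intervalIntegral.intervalIntegral_pos_of_pos (intervalIntegrable_weight hlam x y)
      (fun s => hlam.1 _) (by exact_mod_cast h)
  linarith

lemma treeDist_eq_abs (hlam : IsWeight lam) (x y : ℝ≥0) :
    treeDist lam x y = |rootDist lam x - rootDist lam y| := by
  rcases le_total x y with h | h
  · rw [treeDist_eq_sub hlam h, abs_sub_comm,
      abs_of_nonneg (sub_nonneg.2 ((strictMono_rootDist hlam).monotone h))]
  · rw [treeDist_comm, treeDist_eq_sub hlam h,
      abs_of_nonneg (sub_nonneg.2 ((strictMono_rootDist hlam).monotone h))]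

lemma exists_rootDist_eq (hlam : IsWeight lam) (hd : HasInfiniteDiameter lam) {t : ℝ}
    (ht : 0 ≤ t) : ∃ x, rootDist lam x = t := by
  refine ⟨descendant lam 0 t, ?_⟩
  rw [rootDist, treeDist_comm]
  exact (descendant_spec hlam hd 0 ht).2

lemma treeBall_eq (hlam : IsWeight lam) (x : ℝ≥0) (r : ℝ) :
    treeBall lam x r = rootDist lam ⁻¹' Ioo (rootDist lam x - r) (rootDist lam x + r) := by
  ext y
  simp only [treeBall, mem_ofPred_eq, treeDist_eq_abs hlam, abs_lt, mem_preimage, mem_Ioo]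
  constructor <;> rintro ⟨h1, h2⟩ <;> constructor <;> linarith

lemma halfBall_eq (hlam : IsWeight lam) (x : ℝ≥0) (r : ℝ) :
    halfBall lam x r = rootDist lam ⁻¹' Ico (rootDist lam x) (rootDist lam x + r) := by
  ext y
  simp only [halfBall, mem_ofPred_eq, mem_preimage, mem_Ico, (strictMono_rootDist hlam).le_iff_le]
  refine and_congr_right fun h => ?_
  rw [treeDist_eq_sub hlam h]
  constructor <;> intro <;> linarith

lemma Icc_eq_preimage (hlam : IsWeight lam) (x y : ℝ≥0) :
    Icc x y = rootDist lam ⁻¹' Icc (rootDist lam x) (rootDist lam y) := by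
  ext z
  simp only [mem_preimage, mem_Icc, (strictMono_rootDist hlam).le_iff_le]

lemma rootDist_ancestor (hlam : IsWeight lam) (x : ℝ≥0) {r : ℝ} (hr : 0 ≤ r) :
    rootDist lam (ancestor lam x r) = max (rootDist lam x - r) 0 := by
  obtain ⟨h1, h2⟩ := ancestor_spec hlam x hr
  rw [treeDist_eq_sub hlam h1] at h2
  change _ = min r (rootDist lam x) at h2
  rcases min_cases r (rootDist lam x) with ⟨h, h'⟩ | ⟨h, h'⟩ <;> rw [h] at h2
  · rw [max_eq_left] <;> linarith
  · rw [max_eq_right] <;> linarith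

lemma rootDist_descendant (hlam : IsWeight lam) (hd : HasInfiniteDiameter lam) (x : ℝ≥0) {r : ℝ}
    (hr : 0 ≤ r) : rootDist lam (descendant lam x r) = rootDist lam x + r := by
  obtain ⟨h1, h2⟩ := descendant_spec hlam hd x hr
  rw [treeDist_comm, treeDist_eq_sub hlam h1] at h2
  linarith

/-! ### The measures `ds` and `dμ` -/

lemma aemeasurable_weight {f : ℝ≥0 → ℝ} (hf : IsWeight f) : AEMeasurable f heightMeasure :=
  hf.2.aestronglyMeasurable.aemeasurable

lemma radialMeasure_absolutelyContinuous (f : ℝ≥0 → ℝ) : radialMeasure f ≪ heightMeasure :=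
  withDensity_absolutelyContinuous _ _

lemma radialMeasure_eq_withDensity (hlam : IsWeight lam) (hmu : IsWeight mu) :
    radialMeasure mu =
      (radialMeasure lam).withDensity fun w => ENNReal.ofReal (mu w / lam w) := by
  have h := withDensity_mul₀ (μ := heightMeasure) (aemeasurable_weight hlam).ennreal_ofReal
    (g := fun w => ENNReal.ofReal (mu w / lam w))
    ((aemeasurable_weight hmu).div (aemeasurable_weight hlam)).ennreal_ofReal
  rw [radialMeasure, radialMeasure, ← h]
  congr 1
  ext w
  rw [Pi.mul_apply, ← ENNReal.ofReal_mul (hlam.1 w).le, mul_div_cancel₀ _ (hlam.1 w).ne']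

lemma aemeasurable_density (hlam : IsWeight lam) (hmu : IsWeight mu) :
    AEMeasurable (fun w => mu w / lam w) (radialMeasure lam) :=
  ((aemeasurable_weight hmu).div (aemeasurable_weight hlam)).mono_ac
    (radialMeasure_absolutelyContinuous lam)

lemma setLIntegral_radialMeasure (hlam : IsWeight lam) (hmu : IsWeight mu) {s : Set ℝ≥0}
    (hs : MeasurableSet s) {g : ℝ≥0 → ℝ≥0∞} (hg : AEMeasurable g (radialMeasure lam)) :
    ∫⁻ w in s, g w ∂(radialMeasure mu) =
      ∫⁻ w in s, ENNReal.ofReal (mu w / lam w) * g w ∂(radialMeasure lam) := by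
  rw [radialMeasure_eq_withDensity hlam hmu, restrict_withDensity hs,
    lintegral_withDensity_eq_lintegral_mul₀
      (aemeasurable_density hlam hmu).ennreal_ofReal.restrict hg.restrict]
  rfl

lemma measure_Icc_lt_top {f : ℝ≥0 → ℝ} (hf : IsWeight f) (x y : ℝ≥0) :
    radialMeasure f (Icc x y) < ∞ := by
  have h := (hf.2.integrableOn_isCompact (isCompact_Icc (a := x) (b := y))).lintegral_lt_top
  rwa [radialMeasure, withDensity_apply _ measurableSet_Icc]

lemma measurableSet_preimage_rootDist (hlam : IsWeight lam) {I : Set ℝ} (hI : MeasurableSet I) :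
    MeasurableSet (rootDist lam ⁻¹' I) := (continuous_rootDist hlam).measurable hI

/-- Infinite diameter provides a point at distance `max b 0` from the root, so the set lies in a
compact segment, where the weights are integrable. -/
lemma measure_preimage_ne_top (hlam : IsWeight lam) (hd : HasInfiniteDiameter lam)
    {f : ℝ≥0 → ℝ} (hf : IsWeight f) {I : Set ℝ} {b : ℝ} (hI : ∀ t ∈ I, t ≤ b) :
    radialMeasure f (rootDist lam ⁻¹' I) ≠ ∞ := by
  obtain ⟨y, hy⟩ := exists_rootDist_eq hlam hd (le_max_right b 0)
  refine ((measure_mono ?_).trans_lt (measure_Icc_lt_top hf 0 y)).ne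
  rw [Icc_eq_preimage hlam]
  intro z hz
  refine ⟨?_, ?_⟩
  · rw [rootDist_zero hlam]; exact rootDist_nonneg z
  · rw [hy]; exact (hI _ hz).trans (le_max_left _ _)

lemma length_preimage_Icc (hlam : IsWeight lam) (hd : HasInfiniteDiameter lam) {a b : ℝ}
    (ha : 0 ≤ a) (hab : a ≤ b) :
    radialMeasure lam (rootDist lam ⁻¹' Icc a b) = ENNReal.ofReal (b - a) := by
  obtain ⟨x, rfl⟩ := exists_rootDist_eq hlam hd ha
  obtain ⟨y, rfl⟩ := exists_rootDist_eq hlam hd (ha.trans hab)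
  have hxy : x ≤ y := (strictMono_rootDist hlam).le_iff_le.1 hab
  rw [← Icc_eq_preimage hlam, ← treeDist_eq_sub hlam hxy, treeDist, uIcc_of_le hxy,
    ofReal_measureReal (measure_Icc_lt_top hlam x y).ne]

lemma radialMeasure_singleton (f : ℝ≥0 → ℝ) (x : ℝ≥0) : radialMeasure f {x} = 0 := by
  apply radialMeasure_absolutelyContinuous f
  rw [heightMeasure, measurableEmbedding_toReal.comap_apply]
  simp

lemma measure_pos_of_length_pos (hlam : IsWeight lam) (hmu : IsWeight mu) {s : Set ℝ≥0}
    (hs : radialMeasure lam s ≠ 0) : radialMeasure mu s ≠ 0 := by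
  rw [radialMeasure_eq_withDensity hlam hmu]
  intro h
  apply hs
  rw [withDensity_apply_eq_zero' (aemeasurable_density hlam hmu).ennreal_ofReal] at h
  convert h using 2
  ext w
  simp [div_pos (hmu.1 w) (hlam.1 w)]

/-! ### Hölder's inequality and its converse -/

/-- Hölder's inequality for `g = (g w^(1/p)) · w^(-1/p)` with `w = μ/λ`; the conjugate power of the
second factor is `w^(1/(1-p))`. -/
lemma lintegral_rpow_le_of_one_lt (hlam : IsWeight lam) (hmu : IsWeight mu) {p : ℝ} (hp : 1 < p)
    {s : Set ℝ≥0} (hs : MeasurableSet s) {g : ℝ≥0 → ℝ≥0∞} (hg : Measurable g) :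
    (∫⁻ w in s, g w ∂(radialMeasure lam)) ^ p ≤ (∫⁻ w in s, g w ^ p ∂(radialMeasure mu)) *
      (∫⁻ w in s, ENNReal.ofReal ((mu w / lam w) ^ (1 / (1 - p))) ∂(radialMeasure lam)) ^
        (p - 1) := by
  have hp0 : 0 < p := by linarith
  have hp1 : 0 < p - 1 := by linarith
  have hpq := Real.HolderConjugate.conjExponent hp
  have hw := (aemeasurable_density hlam hmu).restrict (s := s)
  have hpos : ∀ w, 0 < mu w / lam w := fun w => div_pos (hmu.1 w) (hlam.1 w)
  have key := ENNReal.lintegral_mul_le_Lp_mul_Lq ((radialMeasure lam).restrict s) hpq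
    (f := fun w => g w * ENNReal.ofReal ((mu w / lam w) ^ (1 / p)))
    (g := fun w => ENNReal.ofReal ((mu w / lam w) ^ (-(1 / p))))
    (hg.aemeasurable.mul (hw.pow_const _).ennreal_ofReal) (hw.pow_const _).ennreal_ofReal
  have e1 : ∀ w, (g w * ENNReal.ofReal ((mu w / lam w) ^ (1 / p))) *
      ENNReal.ofReal ((mu w / lam w) ^ (-(1 / p))) = g w := by
    intro w
    rw [mul_assoc, ← ENNReal.ofReal_mul (Real.rpow_nonneg (hpos w).le _),
      ← Real.rpow_add (hpos w), add_neg_cancel, Real.rpow_zero, ENNReal.ofReal_one, mul_one]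
  have e2 : ∀ w, (g w * ENNReal.ofReal ((mu w / lam w) ^ (1 / p))) ^ p =
      ENNReal.ofReal (mu w / lam w) * g w ^ p := by
    intro w
    rw [ENNReal.mul_rpow_of_nonneg _ _ hp0.le,
      ENNReal.ofReal_rpow_of_nonneg (Real.rpow_nonneg (hpos w).le _) hp0.le,
      ← Real.rpow_mul (hpos w).le, one_div_mul_cancel hp0.ne', Real.rpow_one, mul_comm]
  have e3 : ∀ w, ENNReal.ofReal ((mu w / lam w) ^ (-(1 / p))) ^ p.conjExponent =
      ENNReal.ofReal ((mu w / lam w) ^ (1 / (1 - p))) := by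
    intro w
    rw [ENNReal.ofReal_rpow_of_nonneg (Real.rpow_nonneg (hpos w).le _) hpq.symm.nonneg,
      ← Real.rpow_mul (hpos w).le]
    congr 2
    rw [Real.conjExponent]
    have : 1 - p ≠ 0 := by linarith
    field_simp
    ring
  simp only [Pi.mul_apply, e1, e2, e3] at key
  have h4 := ENNReal.rpow_le_rpow key hp0.le
  rw [ENNReal.mul_rpow_of_nonneg _ _ hp0.le, ← ENNReal.rpow_mul, ← ENNReal.rpow_mul,
    one_div_mul_cancel hp0.ne', ENNReal.rpow_one,
    ← setLIntegral_radialMeasure hlam hmu hs (hg.pow_const p).aemeasurable] at h4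
  convert h4 using 3
  rw [Real.conjExponent]
  field_simp

lemma lintegral_le_essSup_mul (hlam : IsWeight lam) (hmu : IsWeight mu)
    {s : Set ℝ≥0} (hs : MeasurableSet s) {g : ℝ≥0 → ℝ≥0∞} (hg : Measurable g) :
    ∫⁻ w in s, g w ∂(radialMeasure lam) ≤ (∫⁻ w in s, g w ∂(radialMeasure mu)) *
      essSup (fun w => ENNReal.ofReal (lam w / mu w)) ((radialMeasure lam).restrict s) := by
  have hw := (aemeasurable_density hlam hmu).restrict (s := s)
  have hm : AEMeasurable (fun w => ENNReal.ofReal (mu w / lam w) * g w)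
      ((radialMeasure lam).restrict s) := hw.ennreal_ofReal.mul hg.aemeasurable
  rw [setLIntegral_radialMeasure hlam hmu hs hg.aemeasurable, ← lintegral_mul_const'' _ hm]
  refine lintegral_mono_ae ?_
  filter_upwards [ENNReal.ae_le_essSup (μ := (radialMeasure lam).restrict s)
    (fun w => ENNReal.ofReal (lam w / mu w))] with w h
  calc g w = ENNReal.ofReal (mu w / lam w) * g w * ENNReal.ofReal (lam w / mu w) := by
        rw [mul_right_comm, ← ENNReal.ofReal_mul (div_pos (hmu.1 w) (hlam.1 w)).le,
          div_mul_div_cancel₀ (hlam.1 w).ne', div_self (hmu.1 w).ne', ENNReal.ofReal_one, one_mul]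
    _ ≤ _ := by gcongr

/-- The extremal function for Hölder is `v = w^(1/(1-p))` with `w = μ/λ`: as `w v^(p-1) = 1`, it
satisfies `∫ v^p dμ = ∫ v ds`, and one factor of this integral cancels. Its integral may be
infinite, so the truncations `min v n` are tested instead, followed by monotone convergence. -/
lemma mul_dual_rpow_le (hlam : IsWeight lam) (hmu : IsWeight mu) {p : ℝ} (hp : 1 < p)
    {s : Set ℝ≥0} (hs : MeasurableSet s) (hfin : radialMeasure lam s ≠ ∞) {m κ : ℝ≥0∞}
    (hm : m ≠ ∞)
    (H : ∀ g : ℝ≥0 → ℝ≥0∞, Measurable g → ∫⁻ w in s, g w ∂(radialMeasure lam) ≠ ∞ →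
      m * (∫⁻ w in s, g w ∂(radialMeasure lam)) ^ p ≤
        κ * ∫⁻ w in s, g w ^ p ∂(radialMeasure mu)) :
    m * (∫⁻ w in s, ENNReal.ofReal ((mu w / lam w) ^ (1 / (1 - p))) ∂(radialMeasure lam)) ^
        (p - 1) ≤ κ := by
  have hp0 : 0 < p := by linarith
  have hp1 : 0 < p - 1 := by linarith
  have hpos : ∀ w, 0 < mu w / lam w := fun w => div_pos (hmu.1 w) (hlam.1 w)
  have hw := ((aemeasurable_density hlam hmu).pow_const (1 / (1 - p))).ennreal_ofReal
  -- The weights are only a.e. measurable, whereas test functions must be Borel; hence a measurable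
  -- representative.
  set v := hw.mk
  have hv : Measurable v := hw.measurable_mk
  have hvw := ae_restrict_of_ae (s := s) hw.ae_eq_mk
  rw [lintegral_congr_ae hvw]
  change m * (∫⁻ w in s, v w ∂(radialMeasure lam)) ^ (p - 1) ≤ κ
  have htend : Filter.Tendsto (fun n : ℕ => ∫⁻ w in s, min (v w) n ∂(radialMeasure lam))
      Filter.atTop (nhds (∫⁻ w in s, v w ∂(radialMeasure lam))) := by
    refine lintegral_tendsto_of_tendsto_of_monotone
      (fun n => (hv.min measurable_const).aemeasurable) ?_ ?_
    · refine Filter.Eventually.of_forall fun w a b hab => ?_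
      have : (a : ℝ≥0∞) ≤ b := by exact_mod_cast hab
      exact min_le_min le_rfl this
    · refine Filter.Eventually.of_forall fun w => ?_
      have := (tendsto_const_nhds (x := v w)).min ENNReal.tendsto_nat_nhds_top
      simpa using this
  have htend' := ENNReal.Tendsto.const_mul (a := m) (htend.ennrpow_const (p - 1)) (Or.inr hm)
  refine le_of_tendsto' htend' fun n => ?_
  have hI : ∫⁻ w in s, min (v w) n ∂(radialMeasure lam) ≠ ∞ := by
    refine ((lintegral_mono fun w => min_le_right _ _).trans_lt ?_).ne
    rw [setLIntegral_const]
    exact ENNReal.mul_lt_top (ENNReal.natCast_lt_top n) hfin.lt_top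
  have h1 := H (fun w => min (v w) n) (hv.min measurable_const) hI
  have h2 : ∫⁻ w in s, min (v w) n ^ p ∂(radialMeasure mu) ≤
      ∫⁻ w in s, min (v w) n ∂(radialMeasure lam) := by
    rw [setLIntegral_radialMeasure hlam hmu hs
      ((hv.min measurable_const).pow_const p).aemeasurable]
    refine lintegral_mono_ae ?_
    filter_upwards [hvw] with w hww
    have e : p = (p - 1) + 1 := by ring
    have h3 : ENNReal.ofReal (mu w / lam w) * v w ^ (p - 1) = 1 := by
      rw [← show _ = v w from hww, ENNReal.ofReal_rpow_of_nonneg (Real.rpow_nonneg (hpos w).le _) hp1.le,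
        ← Real.rpow_mul (hpos w).le, ← ENNReal.ofReal_mul (hpos w).le]
      have : 1 / (1 - p) * (p - 1) = -1 := by
        have : 1 - p ≠ 0 := by linarith
        field_simp
        ring
      rw [this, Real.rpow_neg_one, mul_inv_cancel₀ (hpos w).ne', ENNReal.ofReal_one]
    calc ENNReal.ofReal (mu w / lam w) * min (v w) n ^ p
        = ENNReal.ofReal (mu w / lam w) * min (v w) n ^ (p - 1) * min (v w) n := by
          conv_lhs => rw [e, ENNReal.rpow_add_of_nonneg _ _ hp1.le zero_le_one, ENNReal.rpow_one]
          rw [mul_assoc]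
      _ ≤ ENNReal.ofReal (mu w / lam w) * v w ^ (p - 1) * min (v w) n := by
          gcongr
          exact min_le_left _ _
      _ = _ := by rw [h3, one_mul]
  set I := ∫⁻ w in s, min (v w) n ∂(radialMeasure lam)
  rcases eq_or_ne I 0 with h0 | h0
  · rw [h0, ENNReal.zero_rpow_of_pos hp1, mul_zero]; exact zero_le
  have h3 : m * I ^ (p - 1) * I ≤ κ * I := by
    calc m * I ^ (p - 1) * I = m * I ^ p := by
          have e : p = (p - 1) + 1 := by ring
          conv_rhs => rw [e, ENNReal.rpow_add_of_nonneg _ _ hp1.le zero_le_one, ENNReal.rpow_one]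
          rw [mul_assoc]
      _ ≤ _ := h1.trans (by gcongr)
  exact (ENNReal.mul_le_mul_iff_left h0 hI).1 h3

/-- For `t > κ/m`, testing on the indicator of `E = {λ/μ > t}` gives `m s(E) ≤ κ μ(E) ≤ (κ/t) s(E)`,
where `s(E)` is the length of `E` within the given set; this forces `s(E) = 0`. -/
lemma mul_essSup_le (hlam : IsWeight lam) (hmu : IsWeight mu)
    {s : Set ℝ≥0} (hs : MeasurableSet s) (hfin : radialMeasure lam s ≠ ∞) {m κ : ℝ≥0∞}
    (hm : m ≠ ∞)
    (H : ∀ g : ℝ≥0 → ℝ≥0∞, Measurable g → ∫⁻ w in s, g w ∂(radialMeasure lam) ≠ ∞ →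
      m * ∫⁻ w in s, g w ∂(radialMeasure lam) ≤ κ * ∫⁻ w in s, g w ∂(radialMeasure mu)) :
    m * essSup (fun w => ENNReal.ofReal (lam w / mu w)) ((radialMeasure lam).restrict s) ≤ κ := by
  rcases eq_or_ne m 0 with h0 | h0
  · simp [h0]
  rw [mul_comm, ← ENNReal.le_div_iff_mul_le (Or.inl h0) (Or.inl hm)]
  refine le_of_forall_gt_imp_ge_of_dense fun t ht => ?_
  have hpos : ∀ w, 0 < lam w / mu w := fun w => div_pos (hlam.1 w) (hmu.1 w)
  have hw : AEMeasurable (fun w => ENNReal.ofReal (lam w / mu w)) (radialMeasure lam) :=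
    (((aemeasurable_weight hlam).div (aemeasurable_weight hmu)).mono_ac
      (radialMeasure_absolutelyContinuous lam)).ennreal_ofReal
  set v := hw.mk
  have hv : Measurable v := hw.measurable_mk
  have hvw := ae_restrict_of_ae (s := s) hw.ae_eq_mk
  have ht0 : t ≠ 0 := (zero_le.trans_lt ht).ne'
  rcases eq_or_ne t ∞ with htop | htop
  · simp [htop]
  set E := {w | t < v w}
  have hE : MeasurableSet E := measurableSet_lt measurable_const hv
  have hE2 : (radialMeasure lam).restrict s E ≠ ∞ :=
    ((Measure.restrict_apply hE).trans_le (measure_mono inter_subset_right) |>.trans_lt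
      hfin.lt_top).ne
  have h1 := H (E.indicator 1) (measurable_one.indicator hE)
    (by rwa [lintegral_indicator_one hE])
  have h2 : t * ∫⁻ w in s, E.indicator 1 w ∂(radialMeasure mu) ≤
      (radialMeasure lam).restrict s E := by
    rw [setLIntegral_radialMeasure hlam hmu hs (measurable_one.indicator hE).aemeasurable,
      ← lintegral_const_mul' _ _ htop, ← lintegral_indicator_one hE]
    refine lintegral_mono_ae ?_
    filter_upwards [hvw] with w hww
    by_cases hwE : w ∈ E
    · simp only [hwE, indicator_of_mem, Pi.one_apply, mul_one]
      calc t * ENNReal.ofReal (mu w / lam w) ≤ v w * ENNReal.ofReal (mu w / lam w) := by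
            gcongr; exact le_of_lt hwE
        _ = 1 := by
            rw [← show _ = v w from hww, ← ENNReal.ofReal_mul (hpos w).le,
              div_mul_div_cancel₀ (hmu.1 w).ne', div_self (hlam.1 w).ne', ENNReal.ofReal_one]
    · simp [hwE]
  rw [lintegral_indicator_one hE] at h1
  have h3 : (radialMeasure lam).restrict s E = 0 := by
    by_contra hne
    have h4 : t * m * (radialMeasure lam).restrict s E ≤ κ * (radialMeasure lam).restrict s E :=
      calc t * m * (radialMeasure lam).restrict s E
          = t * (m * (radialMeasure lam).restrict s E) := by ring
        _ ≤ t * (κ * ∫⁻ w in s, E.indicator 1 w ∂(radialMeasure mu)) := by gcongr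
        _ = κ * (t * ∫⁻ w in s, E.indicator 1 w ∂(radialMeasure mu)) := by ring
        _ ≤ _ := by gcongr
    have h5 := (ENNReal.mul_le_mul_iff_left hne hE2).1 h4
    rw [← ENNReal.le_div_iff_mul_le (Or.inl h0) (Or.inl hm)] at h5
    exact absurd h5 (not_le.2 ht)
  refine essSup_le_of_ae_le t ?_
  have h6 : ∀ᵐ w ∂((radialMeasure lam).restrict s), w ∉ E := measure_eq_zero_iff_ae_notMem.1 h3
  filter_upwards [hvw, h6] with w hww hwE
  rw [show _ = v w from hww]
  exact not_lt.1 hwE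

/-! ### The `A_p`-condition as a bound on averages -/

/-- The points at distance between `a` and `b` from the root. -/
abbrev shell (lam : ℝ≥0 → ℝ) (a b : ℝ) : Set ℝ≥0 := rootDist lam ⁻¹' Icc a b

/-- The half ball `F(x̄ʳ, 2r)` for a point `x` at distance `t` from the root. -/
abbrev doubledHalfBall (lam : ℝ≥0 → ℝ) (t r : ℝ) : Set ℝ≥0 :=
  rootDist lam ⁻¹' Ico (max (t - r) 0) (max (t - r) 0 + 2 * r)

/-- The averages of `g` over `[x, x̲ᵣ]` are bounded by `L^p`-averages of `g`, whenever
`0 < r ≤ c d(0, x)`. This is an equivalent form of the `A_p`-condition far from the root. -/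
def AveragingBound (c p : ℝ) (lam mu : ℝ≥0 → ℝ) (K : ℝ≥0∞) : Prop :=
  ∀ t r : ℝ, 0 < r → r ≤ c * t → ∀ g : ℝ≥0 → ℝ≥0∞, Measurable g →
    ∫⁻ w in shell lam t (t + r), g w ∂(radialMeasure lam) ≠ ∞ →
    radialMeasure mu (doubledHalfBall lam t r) *
        (∫⁻ w in shell lam t (t + r), g w ∂(radialMeasure lam)) ^ p ≤
      K * ENNReal.ofReal r ^ p * ∫⁻ w in shell lam t (t + r), g w ^ p ∂(radialMeasure mu)

lemma halfBall_ancestor (hlam : IsWeight lam) (x : ℝ≥0) {r : ℝ} (hr : 0 ≤ r) :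
    halfBall lam (ancestor lam x r) (2 * r) = doubledHalfBall lam (rootDist lam x) r := by
  rw [halfBall_eq hlam, rootDist_ancestor hlam x hr]

lemma Icc_descendant (hlam : IsWeight lam) (hd : HasInfiniteDiameter lam) (x : ℝ≥0) {r : ℝ}
    (hr : 0 ≤ r) :
    Icc x (descendant lam x r) = shell lam (rootDist lam x) (rootDist lam x + r) := by
  rw [Icc_eq_preimage hlam, rootDist_descendant hlam hd x hr]

lemma ennreal_div_mul_le_iff {m Y R K : ℝ≥0∞} (h0 : R ≠ 0) (htop : R ≠ ∞) :
    m / R * Y ≤ K ↔ m * Y ≤ K * R := by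
  rw [← ENNReal.mul_div_right_comm, ENNReal.div_le_iff h0 htop]

lemma div_mul_div_rpow_le_iff {m X R K : ℝ≥0∞} (h0 : R ≠ 0) (htop : R ≠ ∞) (hp : 1 < p) :
    m / (2 * R) * (X / R) ^ (p - 1) ≤ K ↔ m * X ^ (p - 1) ≤ 2 * K * R ^ p := by
  have hp1 : 0 ≤ p - 1 := by linarith
  rw [ennreal_div_mul_le_iff (by simp [h0]) (ENNReal.mul_ne_top (by simp) htop),
    ENNReal.div_rpow_of_nonneg _ _ hp1, ← mul_div_assoc, ENNReal.div_le_iff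
    (by simp [h0, htop]) (ENNReal.rpow_ne_top_of_nonneg hp1 htop)]
  have e : p = 1 + (p - 1) := by ring
  conv_rhs => rw [e, ENNReal.rpow_add _ _ h0 htop, ENNReal.rpow_one, ← e]
  ring_nf

lemma apFarFromRoot_iff : ApFarFromRoot c p lam mu ↔ ∃ K : ℝ≥0∞, K ≠ ∞ ∧
    ∀ x r, 0 < r → r ≤ c * rootDist lam x → apQuantity p lam mu x r ≤ K := by
  constructor
  · intro h
    refine ⟨_, h.ne, fun x r h1 h2 => ?_⟩
    exact le_iSup_of_le x (le_iSup_of_le r (le_iSup_of_le ⟨h1, h2⟩ le_rfl))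
  · rintro ⟨K, hK, h⟩
    exact (iSup_le fun x => iSup_le fun r => iSup_le fun hr => h x r hr.1 hr.2).trans_lt hK.lt_top

lemma exists_averagingBound_of_apFarFromRoot (hlam : IsWeight lam) (hmu : IsWeight mu)
    (hd : HasInfiniteDiameter lam) (hp : 1 ≤ p) (hc : 0 < c) (h : ApFarFromRoot c p lam mu) :
    ∃ K : ℝ≥0∞, K ≠ ∞ ∧ AveragingBound c p lam mu K := by
  obtain ⟨K, hK, h⟩ := apFarFromRoot_iff.1 h
  refine ⟨2 * K, ENNReal.mul_ne_top (by simp) hK, fun t r hr hrt g hg _ => ?_⟩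
  have ht : 0 ≤ t := (pos_of_mul_pos_right (hr.trans_le hrt) hc.le).le
  obtain ⟨x, rfl⟩ := exists_rootDist_eq hlam hd ht
  have hR0 : ENNReal.ofReal r ≠ 0 := by simpa using hr
  have key := h x r hr hrt
  rw [apQuantity, halfBall_ancestor hlam x hr.le, Icc_descendant hlam hd x hr.le,
    ENNReal.ofReal_mul (by norm_num), ENNReal.ofReal_ofNat] at key
  have hs : MeasurableSet (shell lam (rootDist lam x) (rootDist lam x + r)) :=
    measurableSet_preimage_rootDist hlam measurableSet_Icc
  rcases hp.eq_or_lt with rfl | hp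
  · rw [if_pos rfl, ennreal_div_mul_le_iff (by simp [hr])
      (ENNReal.mul_ne_top (by simp) (by simp))] at key
    simp only [ENNReal.rpow_one]
    refine (mul_le_mul_right (lintegral_le_essSup_mul hlam hmu hs hg) _).trans ?_
    rw [mul_comm (∫⁻ w in _, g w ∂(radialMeasure mu)), ← mul_assoc]
    rw [show K * (2 * ENNReal.ofReal r) = 2 * K * ENNReal.ofReal r by ring] at key
    gcongr
  · rw [if_neg hp.ne', div_mul_div_rpow_le_iff hR0 (by simp) hp] at key
    refine (mul_le_mul_right (lintegral_rpow_le_of_one_lt hlam hmu hp hs hg) _).trans ?_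
    rw [mul_comm (∫⁻ w in _, g w ^ p ∂(radialMeasure mu)), ← mul_assoc]
    gcongr

lemma apFarFromRoot_of_averagingBound (hlam : IsWeight lam) (hmu : IsWeight mu)
    (hd : HasInfiniteDiameter lam) (hp : 1 ≤ p) {K : ℝ≥0∞} (hK : K ≠ ∞)
    (h : AveragingBound c p lam mu K) : ApFarFromRoot c p lam mu := by
  refine apFarFromRoot_iff.2 ⟨K, hK, fun x r hr hrt => ?_⟩
  have hR0 : ENNReal.ofReal r ≠ 0 := by simpa using hr
  have hs : MeasurableSet (shell lam (rootDist lam x) (rootDist lam x + r)) :=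
    measurableSet_preimage_rootDist hlam measurableSet_Icc
  have hfin : radialMeasure lam (shell lam (rootDist lam x) (rootDist lam x + r)) ≠ ∞ :=
    measure_preimage_ne_top hlam hd hlam fun _ ht => ht.2
  have hm : radialMeasure mu (doubledHalfBall lam (rootDist lam x) r) ≠ ∞ :=
    measure_preimage_ne_top hlam hd hmu fun _ ht => ht.2.le
  have key := h _ r hr hrt
  rw [apQuantity, halfBall_ancestor hlam x hr.le, Icc_descendant hlam hd x hr.le,
    ENNReal.ofReal_mul (by norm_num), ENNReal.ofReal_ofNat]
  have h2 : ∀ a : ℝ≥0∞, a ≤ 2 * a := fun a => by rw [two_mul]; exact le_self_add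
  rcases hp.eq_or_lt with rfl | hp
  · rw [if_pos rfl, ennreal_div_mul_le_iff (by simp [hr])
      (ENNReal.mul_ne_top (by simp) (by simp))]
    simp only [ENNReal.rpow_one] at key
    exact (mul_essSup_le hlam hmu hs hfin hm key).trans (by gcongr; exact h2 _)
  · rw [if_neg hp.ne', div_mul_div_rpow_le_iff hR0 (by simp) hp]
    exact (mul_dual_rpow_le hlam hmu hp hs hfin hm key).trans (by gcongr; exact h2 _)

/-! ### Necessity: admissibility implies the averaging bound -/

/-- Balls are described by the distance of their centres to the root. -/
lemma exists_measure_ball_le_of_isDoubling (hlam : IsWeight lam) (hd : HasInfiniteDiameter lam)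
    (h : IsDoubling lam mu) : ∃ C : ℝ≥0∞, C ≠ ∞ ∧ ∀ (n : ℕ) (t r : ℝ), 0 ≤ t → 0 < r →
      radialMeasure mu (rootDist lam ⁻¹' Ioo (t - 2 ^ n * r) (t + 2 ^ n * r)) ≤
        C ^ n * radialMeasure mu (rootDist lam ⁻¹' Ioo (t - r) (t + r)) := by
  obtain ⟨C, -, h⟩ := h
  refine ⟨ENNReal.ofReal C, by simp, fun n t r ht hr => ?_⟩
  obtain ⟨x, rfl⟩ := exists_rootDist_eq hlam hd ht
  simp only [← treeBall_eq hlam]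
  induction n with
  | zero => simp
  | succ n ih =>
    calc radialMeasure mu (treeBall lam x (2 ^ (n + 1) * r))
        = radialMeasure mu (treeBall lam x (2 * (2 ^ n * r))) := by ring_nf
      _ ≤ ENNReal.ofReal C * radialMeasure mu (treeBall lam x (2 ^ n * r)) :=
          h x _ (by positivity)
      _ ≤ ENNReal.ofReal C * (ENNReal.ofReal C ^ n * radialMeasure mu (treeBall lam x r)) := by
          gcongr
      _ = _ := by ring

/-- Under doubling, a ball `B(x, 2r)` with `r ≤ c d(0, x)` is comparable both to its part
above `x` and to its part below `x̲ᵣ`. -/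
lemma exists_measure_ball_le_sides (hlam : IsWeight lam) (hd : HasInfiniteDiameter lam)
    (hc : 0 < c) (h : IsDoubling lam mu) : ∃ C : ℝ≥0∞, C ≠ ∞ ∧ ∀ t r : ℝ, 0 < r → r ≤ c * t →
      radialMeasure mu (rootDist lam ⁻¹' Ioo (t - 2 * r) (t + 2 * r)) ≤
        C * radialMeasure mu (rootDist lam ⁻¹' Ioo (t - 2 * r) t) ∧
      radialMeasure mu (rootDist lam ⁻¹' Ioo (t - 2 * r) (t + 2 * r)) ≤
        C * radialMeasure mu (rootDist lam ⁻¹' Ioo (t + r) (t + 2 * r)) := by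
  obtain ⟨C, hC, h⟩ := exists_measure_ball_le_of_isDoubling hlam hd h
  obtain ⟨n, hn⟩ := pow_unbounded_of_one_lt (2 * (1 + c) + 1) (one_lt_two (α := ℝ))
  refine ⟨C ^ n + C ^ 3, ENNReal.add_ne_top.2 ⟨ENNReal.pow_ne_top hC, ENNReal.pow_ne_top hC⟩,
    fun t r hr hrt => ⟨?_, ?_⟩⟩
  -- From `r ≤ c t` follows `ρ ≤ t`, so `t - ρ` is the coordinate of a point whose `ρ`-ball lies
  -- below `t`. Dilating it by `2(1 + c) + 1` gives radius `2r + ρ`, which reaches `t + 2r`.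
  · set ρ := r / (1 + c)
    have hρ : 0 < ρ := by positivity
    have hrρ : r = ρ * (1 + c) := by simp only [ρ]; field_simp
    have hρt : ρ ≤ t := by
      have : ρ * (1 + c) ≤ (1 + c) * t := by rw [← hrρ]; nlinarith
      nlinarith
    have h1 := h n (t - ρ) ρ (by linarith) hρ
    have hn' : (2 * (1 + c) + 1) * ρ ≤ 2 ^ n * ρ := by gcongr
    refine (measure_mono ?_).trans (h1.trans ?_)
    · refine preimage_mono (Ioo_subset_Ioo ?_ ?_) <;> nlinarith
    · exact mul_le_mul' le_self_add (measure_mono (preimage_mono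
        (Ioo_subset_Ioo (by nlinarith) (by linarith))))
  · have ht : 0 ≤ t := (pos_of_mul_pos_right (hr.trans_le hrt) hc.le).le
    -- The ball is exactly `(t + r, t + 2r)`; three doublings give radius `4r`.
    have h1 := h 3 (t + 3 / 2 * r) (r / 2) (by positivity) (by positivity)
    refine (measure_mono ?_).trans (h1.trans ?_)
    · refine preimage_mono (Ioo_subset_Ioo ?_ ?_) <;> linarith
    · exact mul_le_mul' le_add_self (measure_mono (preimage_mono
        (Ioo_subset_Ioo (by linarith) (by linarith))))

lemma isUpperGradient_primitive (g : ℝ≥0 → ℝ≥0∞) (hg : Measurable g)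
    (hfin : ∫⁻ w, g w ∂(radialMeasure lam) ≠ ∞) :
    IsUpperGradient lam (fun y => (∫⁻ w in Icc 0 y, g w ∂(radialMeasure lam)).toReal) g := by
  have hfin' : ∀ s : Set ℝ≥0, ∫⁻ w in s, g w ∂(radialMeasure lam) ≠ ∞ := fun s =>
    ((setLIntegral_le_lintegral s g).trans_lt hfin.lt_top).ne
  refine ⟨hg, fun z y => ?_⟩
  wlog hzy : z ≤ y
  · have := this g hg hfin hfin' y z (le_of_not_ge hzy)
    rwa [abs_sub_comm, uIcc_comm]
  have h1 : ∫⁻ w in Icc 0 z, g w ∂(radialMeasure lam) ≤ ∫⁻ w in Icc 0 y, g w ∂(radialMeasure lam) :=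
    lintegral_mono_set (Icc_subset_Icc le_rfl hzy)
  have h2 : ∫⁻ w in Icc 0 y, g w ∂(radialMeasure lam) ≤
      ∫⁻ w in Icc 0 z, g w ∂(radialMeasure lam) + ∫⁻ w in Icc z y, g w ∂(radialMeasure lam) := by
    rw [← Icc_union_Icc_eq_Icc (zero_le : 0 ≤ z) hzy]
    exact lintegral_union_le _ _ _
  rw [uIcc_of_le hzy, abs_sub_comm,
    abs_of_nonneg (sub_nonneg.2 (ENNReal.toReal_mono (hfin' _) h1)),
    ENNReal.ofReal_sub _ ENNReal.toReal_nonneg, ENNReal.ofReal_toReal (hfin' _),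
    ENNReal.ofReal_toReal (hfin' _)]
  exact tsub_le_iff_left.2 h2

lemma exists_averagingBound_of_isAdmissible (hlam : IsWeight lam) (hmu : IsWeight mu)
    (hd : HasInfiniteDiameter lam) (hp : 1 ≤ p) (hc : 0 < c) (h : IsAdmissible p lam mu) :
    ∃ K : ℝ≥0∞, K ≠ ∞ ∧ AveragingBound c p lam mu K := by
  have hp0 : 0 < p := by linarith
  obtain ⟨hdoub, P, σ, hP, hσ, hpoin⟩ := h
  obtain ⟨C, hC, hsides⟩ := exists_measure_ball_le_sides hlam hd hc hdoub
  refine ⟨(C * ENNReal.ofReal (P * 2)) ^ p, ENNReal.rpow_ne_top_of_nonneg hp0.le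
    (ENNReal.mul_ne_top hC (by simp)), fun t r hr hrt g hg hI => ?_⟩
  have ht : 0 ≤ t := (pos_of_mul_pos_right (hr.trans_le hrt) hc.le).le
  obtain ⟨hL, hR⟩ := hsides t r hr hrt
  obtain ⟨x, hx⟩ := exists_rootDist_eq hlam hd ht
  have hJ : MeasurableSet (shell lam t (t + r)) :=
    measurableSet_preimage_rootDist hlam measurableSet_Icc
  set I := ∫⁻ w in shell lam t (t + r), g w ∂(radialMeasure lam)
  set g' := (shell lam t (t + r)).indicator g
  have hg' : Measurable g' := hg.indicator hJ
  have hI' : ∫⁻ w, g' w ∂(radialMeasure lam) = I := lintegral_indicator hJ g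
  set u : ℝ≥0 → ℝ := fun y => (∫⁻ w in Icc 0 y, g' w ∂(radialMeasure lam)).toReal
  have hle : ∀ y, ∫⁻ w in Icc 0 y, g' w ∂(radialMeasure lam) ≤ I := fun y =>
    (setLIntegral_le_lintegral _ _).trans_eq hI'
  have hu : Monotone u := fun y z hyz => ENNReal.toReal_mono
    ((hle z).trans_lt hI.lt_top).ne (lintegral_mono_set (Icc_subset_Icc le_rfl hyz))
  have hug : IsUpperGradient lam u g' := isUpperGradient_primitive g' hg' (by rwa [hI'])
  set B := rootDist lam ⁻¹' Ioo (t - 2 * r) (t + 2 * r) with hBdef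
  set L := rootDist lam ⁻¹' Ioo (t - 2 * r) t
  set R := rootDist lam ⁻¹' Ioo (t + r) (t + 2 * r)
  set B' := rootDist lam ⁻¹' Ioo (t - σ * (2 * r)) (t + σ * (2 * r)) with hB'def
  have hB : treeBall lam x (2 * r) = B := by rw [treeBall_eq hlam, hx]
  have hB' : treeBall lam x (σ * (2 * r)) = B' := by rw [treeBall_eq hlam, hx]
  have hBfin : radialMeasure mu B ≠ ∞ := measure_preimage_ne_top hlam hd hmu fun _ ht => ht.2.le
  have hB'fin : radialMeasure mu B' ≠ ∞ := measure_preimage_ne_top hlam hd hmu fun _ ht => ht.2.le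
  have hBB' : B ⊆ B' := by
    refine preimage_mono (Ioo_subset_Ioo ?_ ?_) <;> nlinarith
  have hB0 : radialMeasure mu B ≠ 0 := by
    refine measure_pos_of_length_pos hlam hmu fun h0 => ?_
    have : shell lam t (t + r) ⊆ B := preimage_mono fun s hs =>
      ⟨by linarith [hs.1], by linarith [hs.2]⟩
    have h1 := measure_mono_null this h0
    rw [length_preimage_Icc hlam hd ht (by linarith)] at h1
    simp at h1
    linarith
  have hB'0 : radialMeasure mu B' ≠ 0 := (hB0.bot_lt.trans_le (measure_mono hBB')).ne'
  have huint : IntegrableOn u B' (radialMeasure mu) := by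
    refine Measure.integrableOn_of_bounded (M := I.toReal) hB'fin
      hu.measurable.aestronglyMeasurable (Filter.Eventually.of_forall fun y => ?_)
    rw [Real.norm_of_nonneg ENNReal.toReal_nonneg]
    exact ENNReal.toReal_mono hI (hle y)
  have huL : ∀ y ∈ L, u y = 0 := by
    intro y hy
    simp only [u]
    rw [lintegral_congr_ae (g := 0), lintegral_zero_fun, ENNReal.toReal_zero]
    filter_upwards [ae_restrict_mem measurableSet_Icc] with w hw
    refine indicator_of_notMem (fun hw' => ?_) _
    have h1 := (strictMono_rootDist hlam).monotone hw.2
    have h2 : rootDist lam y < t := hy.2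
    have h3 : t ≤ rootDist lam w := hw'.1
    linarith
  have huR : ∀ y ∈ R, u y = I.toReal := by
    intro y hy
    simp only [u]
    congr 1
    refine le_antisymm (hle y) ?_
    rw [← hI', ← lintegral_indicator measurableSet_Icc]
    refine lintegral_mono fun w => ?_
    by_cases hw : w ∈ shell lam t (t + r)
    · rw [indicator_of_mem]
      refine ⟨zero_le, (strictMono_rootDist hlam).le_iff_le.1 ?_⟩
      exact hw.2.trans (le_of_lt hy.1)
    · simp [g', hw]
  have hpo := hpoin x (2 * r) (by positivity) u g' (by rwa [hB']) hug
  rw [hB, hB'] at hpo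
  set a := ⨍ z in B, u z ∂(radialMeasure mu)
  have hLm : MeasurableSet L := measurableSet_preimage_rootDist hlam measurableSet_Ioo
  have hRm : MeasurableSet R := measurableSet_preimage_rootDist hlam measurableSet_Ioo
  have hLR : Disjoint L R := by
    rw [Set.disjoint_left]
    intro y hy hy'
    have h1 : rootDist lam y < t := hy.2
    have h2 : t + r < rootDist lam y := hy'.1
    linarith
  have hLRB : L ∪ R ⊆ B := union_subset (preimage_mono (Ioo_subset_Ioo le_rfl (by linarith)))
    (preimage_mono (Ioo_subset_Ioo (by linarith) le_rfl))
  -- Whatever the mean `a` is, `|0 - a| + |I - a| ≥ I`, and `L` and `R` each carry a fixed fraction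
  -- of `μ(B)`.
  have hlow : I ≤ C * ⨍⁻ y in B, ENNReal.ofReal |u y - a| ∂(radialMeasure mu) := by
    have h1 : ∫⁻ y in L, ENNReal.ofReal |u y - a| ∂(radialMeasure mu) =
        ENNReal.ofReal |a| * radialMeasure mu L := by
      rw [← setLIntegral_const]
      refine setLIntegral_congr_fun hLm fun y hy => ?_
      simp only [huL y hy, zero_sub, abs_neg]
    have h2 : ∫⁻ y in R, ENNReal.ofReal |u y - a| ∂(radialMeasure mu) =
        ENNReal.ofReal |I.toReal - a| * radialMeasure mu R := by
      rw [← setLIntegral_const]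
      refine setLIntegral_congr_fun hRm fun y hy => ?_
      simp only [huR y hy]
    have h3 : I ≤ ENNReal.ofReal |a| + ENNReal.ofReal |I.toReal - a| := by
      rw [← ENNReal.ofReal_add (abs_nonneg _) (abs_nonneg _)]
      conv_lhs => rw [← ENNReal.ofReal_toReal hI]
      refine ENNReal.ofReal_le_ofReal ?_
      calc I.toReal ≤ |a + (I.toReal - a)| := by rw [add_sub_cancel]; exact le_abs_self _
        _ ≤ _ := abs_add_le _ _
    have h4 : I * radialMeasure mu B ≤
        C * ∫⁻ y in B, ENNReal.ofReal |u y - a| ∂(radialMeasure mu) := by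
      calc I * radialMeasure mu B
          ≤ (ENNReal.ofReal |a| + ENNReal.ofReal |I.toReal - a|) * radialMeasure mu B := by gcongr
        _ = ENNReal.ofReal |a| * radialMeasure mu B +
            ENNReal.ofReal |I.toReal - a| * radialMeasure mu B := add_mul _ _ _
        _ ≤ ENNReal.ofReal |a| * (C * radialMeasure mu L) +
            ENNReal.ofReal |I.toReal - a| * (C * radialMeasure mu R) := by gcongr
        _ = C * (∫⁻ y in L, ENNReal.ofReal |u y - a| ∂(radialMeasure mu) +
            ∫⁻ y in R, ENNReal.ofReal |u y - a| ∂(radialMeasure mu)) := by rw [h1, h2]; ring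
        _ = C * ∫⁻ y in L ∪ R, ENNReal.ofReal |u y - a| ∂(radialMeasure mu) := by
            rw [lintegral_union hRm hLR]
        _ ≤ _ := by gcongr
    rw [setLAverage_eq, ← mul_div_assoc, ENNReal.le_div_iff_mul_le (Or.inl hB0) (Or.inl hBfin)]
    exact h4
  have hG : ∫⁻ y in B', g' y ^ p ∂(radialMeasure mu) ≤
      ∫⁻ w in shell lam t (t + r), g w ^ p ∂(radialMeasure mu) := by
    refine (setLIntegral_le_lintegral _ _).trans ?_
    rw [← lintegral_indicator hJ]
    refine lintegral_mono fun w => ?_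
    by_cases hw : w ∈ shell lam t (t + r)
    · simp [g', hw]
    · simp [g', hw, hp0]
  set G := ∫⁻ w in shell lam t (t + r), g w ^ p ∂(radialMeasure mu)
  have hF : radialMeasure mu (doubledHalfBall lam t r) ≤ radialMeasure mu B' := by
    refine measure_mono (Subset.trans (preimage_mono fun s hs => ?_) hBB')
    have h1 := le_max_left (t - r) 0
    refine ⟨by linarith [hs.1], hs.2.trans_le ?_⟩
    rcases max_cases (t - r) 0 with h | h <;> linarith
  have hI1 : I ≤ C * ENNReal.ofReal (P * 2) * ENNReal.ofReal r * (G / radialMeasure mu B') ^ (1 / p) := by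
    refine hlow.trans ?_
    rw [mul_assoc, mul_assoc, ← mul_assoc (ENNReal.ofReal (P * 2)),
      ← ENNReal.ofReal_mul (by positivity), mul_assoc P 2 r]
    gcongr
    refine hpo.trans ?_
    gcongr
    rw [setLAverage_eq]
    gcongr
  calc radialMeasure mu (doubledHalfBall lam t r) * I ^ p
      ≤ radialMeasure mu B' * (C * ENNReal.ofReal (P * 2) * ENNReal.ofReal r *
        (G / radialMeasure mu B') ^ (1 / p)) ^ p := by gcongr
    _ = (C * ENNReal.ofReal (P * 2)) ^ p * ENNReal.ofReal r ^ p *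
        (radialMeasure mu B' * (G / radialMeasure mu B')) := by
        rw [ENNReal.mul_rpow_of_nonneg _ _ hp0.le, ENNReal.mul_rpow_of_nonneg _ _ hp0.le,
          ← ENNReal.rpow_mul, one_div_mul_cancel hp0.ne', ENNReal.rpow_one]
        ring
    _ = _ := by rw [ENNReal.mul_div_cancel hB'0 hB'fin]

/-! ### Sufficiency: doubling -/

/-- `AveragingBound` asks for a finite integral because necessity needs a real-valued primitive.
Truncating `g` and monotone convergence remove this restriction. -/
lemma AveragingBound.mul_lintegral_rpow_le (hlam : IsWeight lam) (hmu : IsWeight mu)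
    (hd : HasInfiniteDiameter lam) (hp : 1 ≤ p)
    (H : AveragingBound c p lam mu K) {t r : ℝ} (hr : 0 < r) (hrt : r ≤ c * t)
    {g : ℝ≥0 → ℝ≥0∞} (hg : Measurable g) :
    radialMeasure mu (doubledHalfBall lam t r) *
        (∫⁻ w in shell lam t (t + r), g w ∂(radialMeasure lam)) ^ p ≤
      K * ENNReal.ofReal r ^ p * ∫⁻ w in shell lam t (t + r), g w ^ p ∂(radialMeasure mu) := by
  have hm : radialMeasure mu (doubledHalfBall lam t r) ≠ ∞ :=
    measure_preimage_ne_top hlam hd hmu fun _ ht => ht.2.le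
  have hJ : radialMeasure lam (shell lam t (t + r)) ≠ ∞ :=
    measure_preimage_ne_top hlam hd hlam fun _ ht => ht.2
  have htend : Filter.Tendsto
      (fun n : ℕ => ∫⁻ w in shell lam t (t + r), min (g w) n ∂(radialMeasure lam))
      Filter.atTop (nhds (∫⁻ w in shell lam t (t + r), g w ∂(radialMeasure lam))) := by
    refine lintegral_tendsto_of_tendsto_of_monotone
      (fun n => (hg.min measurable_const).aemeasurable) ?_ ?_
    · refine Filter.Eventually.of_forall fun w a b hab => ?_
      have : (a : ℝ≥0∞) ≤ b := by exact_mod_cast hab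
      exact min_le_min le_rfl this
    · refine Filter.Eventually.of_forall fun w => ?_
      have := (tendsto_const_nhds (x := g w)).min ENNReal.tendsto_nat_nhds_top
      simpa using this
  refine le_of_tendsto' (ENNReal.Tendsto.const_mul (htend.ennrpow_const p) (Or.inr hm))
    fun n => ?_
  refine (H t r hr hrt (fun w => min (g w) n) (hg.min measurable_const) ?_).trans ?_
  · refine ((lintegral_mono fun w => min_le_right _ _).trans_lt ?_).ne
    rw [setLIntegral_const]
    exact ENNReal.mul_lt_top (ENNReal.natCast_lt_top n) hJ.lt_top
  · gcongr with w
    exact min_le_left _ _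

/-- The test function is the indicator of `[t, t + e]`, whose `ds`-integral is `e`. -/
lemma AveragingBound.measure_doubledHalfBall_le (hlam : IsWeight lam)
    (hd : HasInfiniteDiameter lam) (hp : 1 ≤ p) (hc : 0 < c)
    (H : AveragingBound c p lam mu K) {t r e : ℝ} (he : 0 < e) (her : e ≤ r) (hrt : r ≤ c * t) :
    radialMeasure mu (doubledHalfBall lam t r) ≤
      K * ENNReal.ofReal (r / e) ^ p * radialMeasure mu (shell lam t (t + e)) := by
  have hp0 : 0 < p := by linarith
  have hr : 0 < r := he.trans_le her
  have ht : 0 ≤ t := (pos_of_mul_pos_right (hr.trans_le hrt) hc.le).le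
  have hE : MeasurableSet (shell lam t (t + e)) :=
    measurableSet_preimage_rootDist hlam measurableSet_Icc
  have hsub : shell lam t (t + e) ⊆ shell lam t (t + r) :=
    preimage_mono (Icc_subset_Icc le_rfl (by linarith))
  have h1 : ∫⁻ w in shell lam t (t + r), (shell lam t (t + e)).indicator 1 w
      ∂(radialMeasure lam) = ENNReal.ofReal e := by
    rw [lintegral_indicator_one hE, Measure.restrict_apply hE, inter_eq_left.2 hsub,
      length_preimage_Icc hlam hd ht (by linarith), add_sub_cancel_left]
  have h2 : ∫⁻ w in shell lam t (t + r), (shell lam t (t + e)).indicator (1 : ℝ≥0 → ℝ≥0∞) w ^ p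
      ∂(radialMeasure mu) = radialMeasure mu (shell lam t (t + e)) := by
    rw [← inter_eq_left.2 hsub, ← Measure.restrict_apply hE, ← lintegral_indicator_one hE,
      inter_eq_left.2 hsub]
    refine lintegral_congr fun w => ?_
    by_cases hw : w ∈ shell lam t (t + e) <;> simp [hw, hp0]
  have key := H t r hr hrt _ (measurable_one.indicator hE) (by rw [h1]; simp)
  rw [h1, h2] at key
  have he0 : ENNReal.ofReal e ^ p ≠ 0 := by simp [he]
  have heT : ENNReal.ofReal e ^ p ≠ ∞ := ENNReal.rpow_ne_top_of_nonneg hp0.le (by simp)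
  rw [← ENNReal.le_div_iff_mul_le (Or.inl he0) (Or.inl heT)] at key
  rw [ENNReal.ofReal_div_of_pos he, ENNReal.div_rpow_of_nonneg _ _ hp0.le]
  refine key.trans_eq ?_
  simp only [div_eq_mul_inv]
  ring

lemma AveragingBound.exists_measure_near_root_le (hlam : IsWeight lam)
    (hd : HasInfiniteDiameter lam) (hp : 1 ≤ p) (hc : 1 < c) (hK : K ≠ ∞)
    (H : AveragingBound c p lam mu K) : ∃ C : ℝ≥0∞, C ≠ ∞ ∧ ∀ t : ℝ, 0 < t →
      radialMeasure mu (rootDist lam ⁻¹' Iio (4 * t)) ≤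
        C * radialMeasure mu (rootDist lam ⁻¹' Iio t) := by
  have hp0 : 0 < p := by linarith
  set κ := 2 * c / (1 + c)
  have hκ : 1 < κ := by
    rw [one_lt_div (by positivity)]; linarith
  set C := K * ENNReal.ofReal 2 ^ p
  have hC : C ≠ ∞ := ENNReal.mul_ne_top hK (ENNReal.rpow_ne_top_of_nonneg hp0.le (by simp))
  have step : ∀ t : ℝ, 0 < t → radialMeasure mu (rootDist lam ⁻¹' Iio (κ * t)) ≤
      C * radialMeasure mu (rootDist lam ⁻¹' Iio t) := by
    intro t ht
    -- At `x` the largest admissible radius `c x` exceeds `x`, so the half ball starts at the root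
    -- and is `[0, 2 c x) = [0, κ t)`. The choice `e = c x / 2` keeps the closed shell `[x, x + e]`
    -- strictly below `(1 + c) x = t`.
    set x := t / (1 + c)
    have hx : 0 < x := by positivity
    have hxt : t = x * (1 + c) := by simp only [x]; field_simp
    have hκx : κ * t = 2 * (c * x) := by simp only [x, κ]; field_simp
    have hcx : 0 < c * x := by positivity
    have h1 := H.measure_doubledHalfBall_le hlam hd hp (by linarith) (t := x) (r := c * x)
      (e := c * x / 2) (by positivity) (by linarith) le_rfl
    rw [show c * x / (c * x / 2) = 2 by field_simp] at h1
    refine (measure_mono fun y hy => ?_).trans (h1.trans ?_)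
    · have hy' : rootDist lam y < κ * t := hy
      have h0 : max (x - c * x) 0 = 0 := max_eq_right (by nlinarith)
      simp only [doubledHalfBall, mem_preimage, h0, zero_add]
      exact ⟨rootDist_nonneg y, by linarith⟩
    · refine mul_le_mul' le_rfl (measure_mono (preimage_mono fun s hs => ?_))
      have := hs.2
      simp only [mem_Iio]
      nlinarith
  obtain ⟨n, hn⟩ := pow_unbounded_of_one_lt 4 hκ
  refine ⟨C ^ n, ENNReal.pow_ne_top hC, fun t ht => ?_⟩
  have iter : ∀ n : ℕ, radialMeasure mu (rootDist lam ⁻¹' Iio (κ ^ n * t)) ≤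
      C ^ n * radialMeasure mu (rootDist lam ⁻¹' Iio t) := by
    intro n
    induction n with
    | zero => simp
    | succ n ih =>
      calc radialMeasure mu (rootDist lam ⁻¹' Iio (κ ^ (n + 1) * t))
          = radialMeasure mu (rootDist lam ⁻¹' Iio (κ * (κ ^ n * t))) := by ring_nf
        _ ≤ C * radialMeasure mu (rootDist lam ⁻¹' Iio (κ ^ n * t)) := step _ (by positivity)
        _ ≤ C * (C ^ n * radialMeasure mu (rootDist lam ⁻¹' Iio t)) := by gcongr
        _ = _ := by ring
  exact (measure_mono (preimage_mono (Iio_subset_Iio (by gcongr)))).trans (iter n)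

lemma AveragingBound.exists_measure_ball_le (hlam : IsWeight lam)
    (hd : HasInfiniteDiameter lam) (hp : 1 ≤ p) (hc : 1 < c) (hK : K ≠ ∞)
    (H : AveragingBound c p lam mu K) : ∃ C : ℝ≥0∞, C ≠ ∞ ∧ ∀ t r : ℝ, 0 ≤ t → 0 < r →
      radialMeasure mu (rootDist lam ⁻¹' Ioo (t - 2 * r) (t + 2 * r)) ≤
        C * radialMeasure mu (rootDist lam ⁻¹' Ioo (t - r) (t + r)) := by
  have hp0 : 0 < p := by linarith
  obtain ⟨C, hC, hroot⟩ := H.exists_measure_near_root_le hlam hd hp hc hK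
  have hfin : ∀ a : ℝ, ENNReal.ofReal a ^ p ≠ ∞ := fun a =>
    ENNReal.rpow_ne_top_of_nonneg hp0.le (by simp)
  refine ⟨K * ENNReal.ofReal 4 ^ p + C * (K * ENNReal.ofReal (10 * c) ^ p),
    ENNReal.add_ne_top.2 ⟨ENNReal.mul_ne_top hK (hfin _),
      ENNReal.mul_ne_top hC (ENNReal.mul_ne_top hK (hfin _))⟩, fun t r ht hr => ?_⟩
  rcases le_or_gt (2 * r) (c * t) with hrt | hrt
  · have h1 := H.measure_doubledHalfBall_le hlam hd hp (by linarith) (t := t) (r := 2 * r)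
      (e := r / 2) (by positivity) (by linarith) hrt
    rw [show 2 * r / (r / 2) = 4 by field_simp; norm_num] at h1
    refine (measure_mono fun y hy => ?_).trans (h1.trans ?_)
    · have hy' : t - 2 * r < rootDist lam y := hy.1
      have hy'' : rootDist lam y < t + 2 * r := hy.2
      have h0 := le_max_left (t - 2 * r) 0
      exact ⟨max_le hy'.le (rootDist_nonneg y), by linarith⟩
    · exact mul_le_mul' le_self_add (measure_mono (preimage_mono fun s hs =>
        ⟨by linarith [hs.1], by linarith [hs.2]⟩))
  -- Now `t < 2r`, so the large ball lies in `[0, 4r)`. No radius is admissible at `t = 0`; moving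
  -- up to `y ≥ r / 2` makes `c y` admissible, with half ball `[0, 2 c y) ⊇ [0, r)`, while `[y, y +
  -- r / 4]` stays in `B(x, r)`. The constant `10 c` comes from `y < 5 r / 2`.
  · set y := t + r / 2
    have hy : 0 < y := by positivity
    have htr : t < 2 * r := by nlinarith
    have h1 := H.measure_doubledHalfBall_le hlam hd hp (by linarith) (t := y) (r := c * y)
      (e := r / 4) (by positivity) (by simp only [y]; nlinarith) le_rfl
    have h2 : radialMeasure mu (rootDist lam ⁻¹' Iio r) ≤
        radialMeasure mu (doubledHalfBall lam y (c * y)) := by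
      refine measure_mono fun z hz => ?_
      have hz' : rootDist lam z < r := hz
      have h0 : max (y - c * y) 0 = 0 := max_eq_right (by nlinarith)
      simp only [doubledHalfBall, mem_preimage, h0, zero_add]
      refine ⟨rootDist_nonneg z, hz'.trans_le ?_⟩
      simp only [y]; nlinarith
    have h3 : c * y / (r / 4) ≤ 10 * c := by
      rw [div_le_iff₀ (by positivity)]; simp only [y]; nlinarith
    calc radialMeasure mu (rootDist lam ⁻¹' Ioo (t - 2 * r) (t + 2 * r))
        ≤ radialMeasure mu (rootDist lam ⁻¹' Iio (4 * r)) :=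
          measure_mono (preimage_mono fun s hs => by
            have := hs.2
            simp only [mem_Iio]; linarith)
      _ ≤ C * radialMeasure mu (rootDist lam ⁻¹' Iio r) := hroot r hr
      _ ≤ C * (K * ENNReal.ofReal (c * y / (r / 4)) ^ p *
          radialMeasure mu (shell lam y (y + r / 4))) := by
          gcongr
          exact h2.trans h1
      _ ≤ C * (K * ENNReal.ofReal (10 * c) ^ p *
          radialMeasure mu (rootDist lam ⁻¹' Ioo (t - r) (t + r))) := by
          refine mul_le_mul' le_rfl (mul_le_mul' (by gcongr) ?_)
          refine measure_mono (preimage_mono fun s hs => ?_)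
          have h4 := hs.1
          have h5 := hs.2
          simp only [y] at h4 h5
          exact ⟨by linarith, by linarith⟩
      _ ≤ _ := by
          rw [← mul_assoc]
          exact mul_le_mul' le_add_self le_rfl

lemma AveragingBound.isDoubling (hlam : IsWeight lam)
    (hd : HasInfiniteDiameter lam) (hp : 1 ≤ p) (hc : 1 < c) (hK : K ≠ ∞)
    (H : AveragingBound c p lam mu K) : IsDoubling lam mu := by
  obtain ⟨C, hC, h⟩ := H.exists_measure_ball_le hlam hd hp hc hK
  refine ⟨C.toReal + 1, by positivity, fun x r hr => ?_⟩
  rw [treeBall_eq hlam, treeBall_eq hlam]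
  refine (h _ r (rootDist_nonneg x) hr).trans ?_
  gcongr
  conv_lhs => rw [← ENNReal.ofReal_toReal hC]
  exact ENNReal.ofReal_le_ofReal (by linarith)

/-! ### Sufficiency: the Poincaré inequality -/

lemma setLIntegral_abs_sub_average_le {α : Type*} [MeasurableSpace α] {ν : Measure α} {s : Set α}
    (hs : ν s ≠ ∞) (hs0 : ν s ≠ 0) {u : α → ℝ} (hu : IntegrableOn u s ν) (a : ℝ) :
    ∫⁻ y in s, ENNReal.ofReal |u y - ⨍ z in s, u z ∂ν| ∂ν ≤
      2 * ∫⁻ y in s, ENNReal.ofReal |u y - a| ∂ν := by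
  set m := ⨍ z in s, u z ∂ν with hm
  have h1 : ENNReal.ofReal |a - m| * ν s ≤ ∫⁻ y in s, ENNReal.ofReal |u y - a| ∂ν := by
    have hne : ν.real s ≠ 0 := (ENNReal.toReal_pos hs0 hs).ne'
    have e : ν.real s * (m - a) = ∫ y in s, (u y - a) ∂ν := by
      rw [integral_sub hu (integrableOn_const hs), setIntegral_const, hm, setAverage_eq,
        smul_eq_mul, smul_eq_mul, mul_sub, mul_inv_cancel_left₀ hne]
    calc ENNReal.ofReal |a - m| * ν s = ENNReal.ofReal |a - m| * ENNReal.ofReal (ν.real s) := by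
          rw [ofReal_measureReal hs]
      _ = ‖∫ y in s, (u y - a) ∂ν‖ₑ := by
          rw [← e, Real.enorm_eq_ofReal_abs, abs_mul, abs_of_nonneg measureReal_nonneg,
            abs_sub_comm, mul_comm, ENNReal.ofReal_mul measureReal_nonneg]
      _ ≤ ∫⁻ y in s, ‖u y - a‖ₑ ∂ν := enorm_integral_le_lintegral_enorm _
      _ = _ := by simp only [Real.enorm_eq_ofReal_abs]
  calc ∫⁻ y in s, ENNReal.ofReal |u y - m| ∂ν
      ≤ ∫⁻ y in s, (ENNReal.ofReal |u y - a| + ENNReal.ofReal |a - m|) ∂ν := by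
        refine lintegral_mono fun y => ?_
        rw [← ENNReal.ofReal_add (abs_nonneg _) (abs_nonneg _)]
        exact ENNReal.ofReal_le_ofReal (abs_sub_le _ _ _)
    _ = ∫⁻ y in s, ENNReal.ofReal |u y - a| ∂ν + ENNReal.ofReal |a - m| * ν s := by
        rw [lintegral_add_right _ measurable_const, setLIntegral_const]
    _ ≤ _ := by
        rw [two_mul]
        gcongr

/-- In `μ(s)^p = μ(s)^(p-1) μ(s)` only the last factor is compared with the half ball; the others
are bounded by `μ(B)`. The right side then depends on the shell only through the factor `r`, so it
can be summed over shells inside one `B`. -/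
lemma AveragingBound.measure_mul_lintegral_le (hlam : IsWeight lam) (hmu : IsWeight mu)
    (hd : HasInfiniteDiameter lam) (hp : 1 ≤ p)
    (H : AveragingBound c p lam mu K) {t r : ℝ} (hr : 0 < r) (hrt : r ≤ c * t)
    {g : ℝ≥0 → ℝ≥0∞} (hg : Measurable g) {s B : Set ℝ≥0} (hs : s ⊆ doubledHalfBall lam t r)
    (hsB : s ⊆ B) (hJ : shell lam t (t + r) ⊆ B) :
    radialMeasure mu s * ∫⁻ w in shell lam t (t + r), g w ∂(radialMeasure lam) ≤
      ENNReal.ofReal r * (radialMeasure mu B ^ (p - 1) *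
        (K * ∫⁻ w in B, g w ^ p ∂(radialMeasure mu))) ^ (1 / p) := by
  have hp0 : 0 < p := by linarith
  have hp1 : 0 ≤ p - 1 := by linarith
  set I := ∫⁻ w in shell lam t (t + r), g w ∂(radialMeasure lam)
  have e : ∀ a : ℝ≥0∞, (a ^ p) ^ (1 / p) = a := fun a => by
    rw [← ENNReal.rpow_mul, mul_one_div_cancel hp0.ne', ENNReal.rpow_one]
  rw [← e (radialMeasure mu s * I), ← e (ENNReal.ofReal r),
    ← ENNReal.mul_rpow_of_nonneg _ _ (by positivity : 0 ≤ 1 / p)]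
  refine ENNReal.rpow_le_rpow ?_ (by positivity)
  calc (radialMeasure mu s * I) ^ p
      = radialMeasure mu s ^ (p - 1) * (radialMeasure mu s * I ^ p) := by
        rw [ENNReal.mul_rpow_of_nonneg _ _ hp0.le, ← mul_assoc]
        congr 1
        conv_lhs => rw [show p = (p - 1) + 1 by ring,
          ENNReal.rpow_add_of_nonneg _ _ hp1 zero_le_one, ENNReal.rpow_one]
    _ ≤ radialMeasure mu s ^ (p - 1) * (radialMeasure mu (doubledHalfBall lam t r) * I ^ p) := by
        gcongr
    _ ≤ radialMeasure mu B ^ (p - 1) * (K * ENNReal.ofReal r ^ p *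
        ∫⁻ w in shell lam t (t + r), g w ^ p ∂(radialMeasure mu)) :=
        mul_le_mul' (ENNReal.rpow_le_rpow (measure_mono hsB) hp1)
          (H.mul_lintegral_rpow_le hlam hmu hd hp hr hrt hg)
    _ ≤ radialMeasure mu B ^ (p - 1) * (K * ENNReal.ofReal r ^ p *
        ∫⁻ w in B, g w ^ p ∂(radialMeasure mu)) := by
        gcongr
    _ = _ := by ring

/-- The shells between radii `b/(1+c)^(k+1)` and `b/(1+c)^k` tile `(0, b]`; the summands are their
lengths. -/
lemma tsum_ofReal_geometric_shells (hc : 0 < c) {b : ℝ} (hb : 0 ≤ b) :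
    ∑' k : ℕ, ENNReal.ofReal (c * (b / (1 + c) ^ (k + 1))) = ENNReal.ofReal b := by
  have hq : 0 ≤ 1 / (1 + c) := by positivity
  have hq1 : 1 / (1 + c) < 1 := by rw [div_lt_one (by positivity)]; linarith
  have hsum := (hasSum_geometric_of_lt_one hq hq1).mul_left (c * b / (1 + c))
  have he : ∀ k : ℕ, c * (b / (1 + c) ^ (k + 1)) = c * b / (1 + c) * (1 / (1 + c)) ^ k := by
    intro k
    rw [one_div, inv_pow, pow_succ]
    field_simp
  simp only [he]
  rw [← ENNReal.ofReal_tsum_of_nonneg (fun k => by positivity) hsum.summable, hsum.tsum_eq]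
  congr 1
  have : 1 - 1 / (1 + c) = c / (1 + c) := by field_simp; ring
  rw [this]
  field_simp

/-- Near the root, the oscillation is summed over the shells with radii `b (1 + c)⁻ᵏ`. -/
lemma AveragingBound.lintegral_oscillation_near_root_le (hlam : IsWeight lam) (hmu : IsWeight mu)
    (hd : HasInfiniteDiameter lam) (hp : 1 ≤ p) (hc : 1 < c)
    (H : AveragingBound c p lam mu K) {g : ℝ≥0 → ℝ≥0∞} (hg : Measurable g) {z : ℝ≥0}
    (hz : 0 < rootDist lam z) {s B : Set ℝ≥0} (hB : shell lam 0 (rootDist lam z) ⊆ B) :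
    ∫⁻ y in s, (∫⁻ w in Icc y z, g w ∂(radialMeasure lam)) ∂(radialMeasure mu) ≤
      ENNReal.ofReal (rootDist lam z) * (radialMeasure mu B ^ (p - 1) *
        (K * ∫⁻ w in B, g w ^ p ∂(radialMeasure mu))) ^ (1 / p) := by
  set b := rootDist lam z
  set Q := (radialMeasure mu B ^ (p - 1) *
        (K * ∫⁻ w in B, g w ^ p ∂(radialMeasure mu))) ^ (1 / p)
  have hc0 : 0 < c := by linarith
  set q : ℕ → ℝ := fun k => b / (1 + c) ^ k with hq
  have hqpos : ∀ k, 0 < q k := fun k => by positivity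
  have hqs : ∀ k, q k = q (k + 1) + c * q (k + 1) := by
    intro k; simp only [hq, pow_succ]; field_simp
  have hqb : ∀ k, q k ≤ b := fun k => div_le_self hz.le (one_le_pow₀ (by linarith))
  set A : ℕ → Set ℝ≥0 := fun k => shell lam 0 (q k)
  set J : ℕ → Set ℝ≥0 := fun k => shell lam (q (k + 1)) (q (k + 1) + c * q (k + 1))
  have hA : ∀ k, MeasurableSet (A k) := fun k =>
    measurableSet_preimage_rootDist hlam measurableSet_Icc
  -- The shells miss the root, which is a null set. If `w ≥ y` lies in the shell `J k`, then `y`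
  -- lies below its outer radius, so `y ∈ A k`; integrating in `y` gives the weight `μ(A k)`.
  have hpt : ∀ y ≠ 0, ∫⁻ w in Icc y z, g w ∂(radialMeasure lam) ≤
      ∑' k, (A k).indicator (fun _ => ∫⁻ w in J k, g w ∂(radialMeasure lam)) y := by
    intro y hy
    have hy0 : 0 < rootDist lam y := by
      rw [← rootDist_zero hlam]; exact strictMono_rootDist hlam (pos_iff_ne_zero.2 hy)
    have hcov : Icc y z ⊆ ⋃ k, {w | y ∈ A k ∧ w ∈ J k} := by
      intro w hw
      have hyw : rootDist lam y ≤ rootDist lam w := (strictMono_rootDist hlam).monotone hw.1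
      have hwb : rootDist lam w ≤ b := (strictMono_rootDist hlam).monotone hw.2
      have hw0 := hy0.trans_le hyw
      obtain ⟨k, hk1, hk2⟩ := exists_nat_pow_near ((one_le_div hw0).2 hwb)
        (show 1 < 1 + c by linarith)
      have h1 : rootDist lam w ≤ q k := by
        rw [le_div_iff₀ hw0] at hk1
        rw [hq, le_div_iff₀ (by positivity)]; linarith
      have h2 : q (k + 1) ≤ rootDist lam w := by
        rw [div_lt_iff₀ hw0] at hk2
        rw [hq, div_le_iff₀ (by positivity)]; linarith
      exact mem_iUnion.2 ⟨k, ⟨hy0.le, hyw.trans h1⟩, h2, by rw [← hqs]; exact h1⟩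
    refine (lintegral_mono_set hcov).trans ((lintegral_iUnion_le _ _).trans ?_)
    refine ENNReal.tsum_le_tsum fun k => ?_
    by_cases hyA : y ∈ A k <;> simp [hyA]
  have hne : ∀ᵐ y ∂((radialMeasure mu).restrict s), y ≠ 0 :=
    ae_restrict_of_ae (by simpa using measure_eq_zero_iff_ae_notMem.1 (radialMeasure_singleton mu 0))
  calc ∫⁻ y in s, (∫⁻ w in Icc y z, g w ∂(radialMeasure lam)) ∂(radialMeasure mu)
      ≤ ∫⁻ y in s, ∑' k, (A k).indicator (fun _ => ∫⁻ w in J k, g w ∂(radialMeasure lam)) y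
          ∂(radialMeasure mu) := lintegral_mono_ae (hne.mono hpt)
    _ ≤ ∫⁻ y, ∑' k, (A k).indicator (fun _ => ∫⁻ w in J k, g w ∂(radialMeasure lam)) y
          ∂(radialMeasure mu) := setLIntegral_le_lintegral _ _
    _ = ∑' k, radialMeasure mu (A k) * ∫⁻ w in J k, g w ∂(radialMeasure lam) := by
        rw [lintegral_tsum fun k => (measurable_const.indicator (hA k)).aemeasurable]
        refine tsum_congr fun k => ?_
        rw [lintegral_indicator_const (hA k), mul_comm]
    _ ≤ ∑' k, ENNReal.ofReal (c * q (k + 1)) * Q := by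
        refine ENNReal.tsum_le_tsum fun k => ?_
        have hk := hqpos (k + 1)
        have hAB : A k ⊆ B := (preimage_mono (Icc_subset_Icc le_rfl (hqb k))).trans hB
        refine H.measure_mul_lintegral_le hlam hmu hd hp (by positivity) le_rfl hg ?_ hAB ?_
        -- The half ball is `[0, 2 c q (k + 1))`, and `c > 1` makes it contain the closed set `A k`,
        -- of radius `(1 + c) q (k + 1)`.
        · have h0 : max (q (k + 1) - c * q (k + 1)) 0 = 0 := max_eq_right (by nlinarith)
          refine preimage_mono ?_
          rw [h0, zero_add]
          exact fun t ht => ⟨ht.1, ht.2.trans_lt (by rw [hqs k]; nlinarith)⟩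
        · rw [← hqs]
          exact (preimage_mono (Icc_subset_Icc hk.le le_rfl)).trans hAB
    _ = _ := by
        rw [ENNReal.tsum_mul_right, tsum_ofReal_geometric_shells hc0 hz.le]

/-- If `2r ≤ c (t - r)`, one averaging bound on the single shell `[t - r, t + r]` suffices;
otherwise the shell decomposition at the root applies. -/
lemma AveragingBound.lintegral_oscillation_le (hlam : IsWeight lam) (hmu : IsWeight mu)
    (hd : HasInfiniteDiameter lam) (hp : 1 ≤ p) (hc : 1 < c)
    (H : AveragingBound c p lam mu K) {g : ℝ≥0 → ℝ≥0∞} (hg : Measurable g) {t r : ℝ}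
    (ht : 0 ≤ t) (hr : 0 < r) {z : ℝ≥0} (hz : rootDist lam z = t + r) :
    ∫⁻ y in rootDist lam ⁻¹' Ioo (t - r) (t + r), (∫⁻ w in Icc y z, g w ∂(radialMeasure lam))
        ∂(radialMeasure mu) ≤
      ENNReal.ofReal (4 * r) *
        (radialMeasure mu (rootDist lam ⁻¹' Ioo (t - 3 * r) (t + 3 * r)) ^ (p - 1) *
        (K * ∫⁻ w in rootDist lam ⁻¹' Ioo (t - 3 * r) (t + 3 * r),
          g w ^ p ∂(radialMeasure mu))) ^ (1 / p) := by
  rcases le_or_gt (2 * r) (c * (t - r)) with hfar | hnear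
  · have hshell : shell lam (t - r) (t - r + 2 * r) ⊆
        rootDist lam ⁻¹' Ioo (t - 3 * r) (t + 3 * r) :=
      preimage_mono fun s hs => ⟨by linarith [hs.1], by linarith [hs.2]⟩
    have h1 := H.measure_mul_lintegral_le hlam hmu hd hp (t := t - r) (r := 2 * r)
      (s := rootDist lam ⁻¹' Ioo (t - r) (t + r)) (by positivity) hfar hg
      (preimage_mono fun s hs => ⟨?_, ?_⟩)
      (preimage_mono (Ioo_subset_Ioo (by linarith) (by linarith))) hshell
    · calc ∫⁻ y in rootDist lam ⁻¹' Ioo (t - r) (t + r),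
            (∫⁻ w in Icc y z, g w ∂(radialMeasure lam)) ∂(radialMeasure mu)
          ≤ ∫⁻ y in rootDist lam ⁻¹' Ioo (t - r) (t + r),
            (∫⁻ w in shell lam (t - r) (t - r + 2 * r), g w ∂(radialMeasure lam))
              ∂(radialMeasure mu) := by
            refine setLIntegral_mono measurable_const fun y hy => lintegral_mono_set ?_
            rw [Icc_eq_preimage hlam, hz]
            exact preimage_mono (Icc_subset_Icc (le_of_lt hy.1) (by linarith))
        _ ≤ _ := by
            rw [setLIntegral_const, mul_comm]
            refine h1.trans ?_
            gcongr
            norm_num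
    · have htr : 0 < t - r := by
        have : 0 < c * (t - r) := by linarith
        exact pos_of_mul_pos_right this (by linarith)
      exact max_le (by linarith [hs.1]) (by linarith [hs.1])
    · have h0 := le_max_left (t - r - 2 * r) 0
      linarith [hs.2]
  -- Hence the ball of radius `3r` contains all of `[0, z]`, which is why the dilation is `3`, and
  -- `d(0, z) = t + r < 4r`.
  · have htr : t < 3 * r := by nlinarith
    refine (H.lintegral_oscillation_near_root_le hlam hmu hd hp hc hg (by rw [hz]; linarith)
      (B := rootDist lam ⁻¹' Ioo (t - 3 * r) (t + 3 * r)) ?_).trans ?_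
    · rw [hz]
      exact preimage_mono fun s hs => ⟨by linarith [hs.1], by linarith [hs.2]⟩
    · rw [hz]
      gcongr
      linarith

lemma AveragingBound.supportsPoincare (hlam : IsWeight lam) (hmu : IsWeight mu)
    (hd : HasInfiniteDiameter lam) (hp : 1 ≤ p) (hc : 1 < c) (hK : K ≠ ∞)
    (H : AveragingBound c p lam mu K) : SupportsPoincare p lam mu := by
  have hp0 : 0 < p := by linarith
  have hp1 : 0 ≤ p - 1 := by linarith
  obtain ⟨C, hC, hdoub⟩ := H.exists_measure_ball_le hlam hd hp hc hK
  set P := 8 * C ^ 2 * K ^ (1 / p)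
  have hP : P ≠ ∞ := ENNReal.mul_ne_top (ENNReal.mul_ne_top (by simp) (ENNReal.pow_ne_top hC))
    (ENNReal.rpow_ne_top_of_nonneg (by positivity) hK)
  refine ⟨P.toReal + 1, 3, by positivity, by norm_num, fun x r hr u g hu hug => ?_⟩
  have hsub : treeBall lam x r ⊆ treeBall lam x (3 * r) := by
    rw [treeBall_eq hlam, treeBall_eq hlam]
    exact preimage_mono (Ioo_subset_Ioo (by linarith) (by linarith))
  have hu1 := hu.mono_set hsub
  rw [treeBall_eq hlam] at hsub hu1 ⊢
  rw [treeBall_eq hlam] at hsub hu ⊢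
  have ht := rootDist_nonneg (lam := lam) x
  set t := rootDist lam x
  obtain ⟨z, hz⟩ := exists_rootDist_eq hlam hd (t := t + r) (by linarith)
  have hosc := H.lintegral_oscillation_le hlam hmu hd hp hc hug.1 ht hr hz
  set B := rootDist lam ⁻¹' Ioo (t - r) (t + r) with hBdef
  set B' := rootDist lam ⁻¹' Ioo (t - 3 * r) (t + 3 * r)
  have hBm : MeasurableSet B := measurableSet_preimage_rootDist hlam measurableSet_Ioo
  have hBfin : radialMeasure mu B ≠ ∞ := measure_preimage_ne_top hlam hd hmu fun _ ht => ht.2.le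
  have hB'fin : radialMeasure mu B' ≠ ∞ := measure_preimage_ne_top hlam hd hmu fun _ ht => ht.2.le
  have hB0 : radialMeasure mu B ≠ 0 := by
    refine measure_pos_of_length_pos hlam hmu fun h0 => ?_
    have : shell lam t (t + r / 2) ⊆ B := preimage_mono fun s hs =>
      ⟨by linarith [hs.1], by linarith [hs.2]⟩
    have h1 := measure_mono_null this h0
    rw [length_preimage_Icc hlam hd ht (by linarith)] at h1
    simp at h1
    linarith
  have hB'0 : radialMeasure mu B' ≠ 0 := (hB0.bot_lt.trans_le (measure_mono hsub)).ne'
  have hB'B : radialMeasure mu B' ≤ C ^ 2 * radialMeasure mu B := by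
    have h1 := hdoub t (2 * r) ht (by positivity)
    have h2 := hdoub t r ht hr
    calc radialMeasure mu B'
        ≤ radialMeasure mu (rootDist lam ⁻¹' Ioo (t - 2 * (2 * r)) (t + 2 * (2 * r))) :=
          measure_mono (preimage_mono (Ioo_subset_Ioo (by linarith) (by linarith)))
      _ ≤ C * (C * radialMeasure mu B) := h1.trans (by gcongr)
      _ = _ := by ring
  set G := ∫⁻ w in B', g w ^ p ∂(radialMeasure mu)
  -- Writing `μ(B')^(p-1) = μ(B')^p / μ(B')` turns the bound into `μ(B')` times an `L^p`-average.
  have hQ : (radialMeasure mu B' ^ (p - 1) * (K * G)) ^ (1 / p) =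
      radialMeasure mu B' * (K ^ (1 / p) * (G / radialMeasure mu B') ^ (1 / p)) := by
    have e : radialMeasure mu B' ^ (p - 1) * (K * G) =
        radialMeasure mu B' ^ p * (K * (G / radialMeasure mu B')) := by
      conv_rhs => rw [show p = (p - 1) + 1 by ring,
        ENNReal.rpow_add_of_nonneg _ _ hp1 zero_le_one, ENNReal.rpow_one]
      rw [mul_assoc, mul_left_comm (radialMeasure mu B') K,
        ENNReal.mul_div_cancel hB'0 hB'fin]
    rw [e, ENNReal.mul_rpow_of_nonneg _ _ (by positivity), ← ENNReal.rpow_mul,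
      mul_one_div_cancel hp0.ne', ENNReal.rpow_one,
      ENNReal.mul_rpow_of_nonneg _ _ (by positivity)]
  -- Every `y ∈ B` lies below `z`, so `|u y - u z|` is at most the integral of `g` over `[y, z]`;
  -- replacing the mean by `u z` costs the factor `2`.
  have hmain : ∫⁻ y in B, ENNReal.ofReal |u y - ⨍ z in B, u z ∂(radialMeasure mu)|
      ∂(radialMeasure mu) ≤ 2 * (ENNReal.ofReal (4 * r) *
        (radialMeasure mu B' ^ (p - 1) * (K * G)) ^ (1 / p)) := by
    refine (setLIntegral_abs_sub_average_le hBfin hB0 hu1 (u z)).trans ?_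
    gcongr
    refine le_trans (setLIntegral_mono' hBm fun y hy => ?_) hosc
    have hyz : y ≤ z := (strictMono_rootDist hlam).le_iff_le.1 (by rw [hz]; exact le_of_lt hy.2)
    have := hug.2 y z
    rwa [uIcc_of_le hyz] at this
  rw [setLAverage_eq, setLAverage_eq, ENNReal.div_le_iff hB0 hBfin]
  set T := (G / radialMeasure mu B') ^ (1 / p)
  calc _ ≤ _ := hmain
    _ = 8 * ENNReal.ofReal r * K ^ (1 / p) * T * radialMeasure mu B' := by
        rw [hQ, ENNReal.ofReal_mul (by norm_num), ENNReal.ofReal_ofNat]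
        ring
    _ ≤ 8 * ENNReal.ofReal r * K ^ (1 / p) * T * (C ^ 2 * radialMeasure mu B) := by gcongr
    _ = P * ENNReal.ofReal r * T * radialMeasure mu B := by simp only [P]; ring
    _ ≤ _ := by
        gcongr
        rw [ENNReal.ofReal_mul (by positivity)]
        gcongr
        conv_lhs => rw [← ENNReal.ofReal_toReal hP]
        exact ENNReal.ofReal_le_ofReal (by linarith)

end RegularTree

theorem mainTheorem2 (p : ℝ) (hp : 1 ≤ p) (c : ℝ) (hc : 1 < c)
    (lam mu : ℝ≥0 → ℝ) (hlam : RegularTree.IsWeight lam) (hmu : RegularTree.IsWeight mu)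
    (hdiam : RegularTree.HasInfiniteDiameter lam) :
    RegularTree.IsAdmissible p lam mu ↔ RegularTree.ApFarFromRoot c p lam mu := by
  have hc0 : 0 < c := by linarith
  constructor
  · intro h
    obtain ⟨K, hK, H⟩ :=
      RegularTree.exists_averagingBound_of_isAdmissible hlam hmu hdiam hp hc0 h
    exact RegularTree.apFarFromRoot_of_averagingBound hlam hmu hdiam hp hK H
  · intro h
    obtain ⟨K, hK, H⟩ :=
      RegularTree.exists_averagingBound_of_apFarFromRoot hlam hmu hdiam hp hc0 h
    exact ⟨H.isDoubling hlam hdiam hp hc hK, H.supportsPoincare hlam hmu hdiam hp hc hK⟩
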